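/- For a finite simple graph $G$ let $\delta(G)$ be its minimum degree and $\kappa(G)$ its vertex-connectivity, i.e. the largest integer $k$ such that $G$ is $k$-connected (has more than $k$ vertices and stays connected after deleting any set of fewer than $k$ vertices); so $\kappa(G)=0$ if $G$ is disconnected. Let $\mathbb{G}(n,p)$ be the binomial random graph on $[n]=\{1,\dots,n\}$; all graphs below have vertex set $[n]$, and unions are unions of edge sets. "A.a.s." means with probability tending to $1$ as $n\to\infty$; $\log$ is the natural logarithm. Throughout, $k=k(n)$ and $s=s(n)$ are positive integers with $k\le s/17$ for every $n$. (a) There is an absolute constant $c_0>0$ such that the following holds for every constant $c\ge c_0$ and all such $k,s$ with $s=o(n)$. If, for all sufficiently large $n$, $G=G_n$ is an $n$-vertex graph with $\delta(G)=s$ and $p=p(n)\in[0,1]$ satisfies $p\ge \frac{c\,(k+\log(n/s))}{ns}$, then a.a.s. $\kappa(G\cup\mathbb{G}(n,p))\ge k$. (b) For all such $k,s$ there are $n$-vertex graphs $G_0=G_0(n)$ with the following two properties. First, for every $n\ge 2(s+1)$ one has $\delta(G_0)\ge s$, and $\kappa(G_0\cup H)<k$ for every graph $H$ on $[n]$ with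 fewer than $\frac{k}{2}\left\lfloor \frac{n}{s+1}\right\rfloor$ edges. Moreover, if $s\to\infty$ and $s=o(n)$, then there is a function $\varepsilon(n)\to0$ such that $\kappa(G_0\cup\mathbb{G}(n,p))=0$ holds a.a.s. whenever $p=p(n)\in[0,1]$ satisfies $p\le\frac{(1-\varepsilon(n))\log(n/s)}{ns}$ for all sufficiently large $n$. -/

import Mathlib

open Filter Topology Asymptotics
open scoped unitInterval

/-- The minimum degree `δ(G)` of a finite graph (Mathlib's `SimpleGraph.minDegree`, with the
adjacency relation made decidable classically). -/
noncomputable def minDeg {V : Type*} [Fintype V] (G : SimpleGraph V) : ℕ :=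
  @SimpleGraph.minDegree V G _ (Classical.decRel G.Adj)

/-- `G` is `k`-(vertex-)connected: it has more than `k` vertices, and deleting any set of fewer
than `k` vertices leaves a connected graph. -/
def IsVertexConnected {V : Type*} [Fintype V] (G : SimpleGraph V) (k : ℕ) : Prop :=
  k < Fintype.card V ∧
    ∀ X : Finset V, X.card < k → (G.induce {v : V | v ∉ X}).Connected

/-- The vertex-connectivity `κ(G)`: the greatest `k` such that `G` is `k`-connected. The set of
such `k` is bounded by the number of vertices, and it contains `0` if there is a vertex; a
disconnected graph and a graph with at most one vertex have `κ = 0`. -/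
noncomputable def vertexConnectivity {V : Type*} [Fintype V] (G : SimpleGraph V) : ℕ :=
  sSup {k : ℕ | IsVertexConnected G k}

theorem le_vertexConnectivity_iff {V : Type*} [Fintype V] (G : SimpleGraph V) {k : ℕ}
    (hk : 0 < k) : k ≤ vertexConnectivity G ↔ IsVertexConnected G k := by
  have hb : BddAbove {k : ℕ | IsVertexConnected G k} :=
    ⟨Fintype.card V, fun j hj => hj.1.le⟩
  constructor
  · intro h
    have hne : {k : ℕ | IsVertexConnected G k}.Nonempty := by
      by_contra hc
      rw [Set.not_nonempty_iff_eq_empty] at hc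
      rw [vertexConnectivity, hc, csSup_empty] at h
      exact absurd h (Nat.not_le.2 hk)
    have hm : IsVertexConnected G (vertexConnectivity G) := Nat.sSup_mem hne hb
    exact ⟨h.trans_lt hm.1, fun X hX => hm.2 X (hX.trans_le h)⟩
  · intro h
    exact le_csSup hb h

/-- The random graph `R ∼ 𝔾(n, p(n))` on the vertex set `Fin n` asymptotically almost surely
satisfies `P n`: the probability of `P n R` tends to `1` as `n` tends to infinity. -/
def AAS (p : ℕ → I) (P : ∀ n : ℕ, SimpleGraph (Fin n) → Prop) : Prop :=
  Tendsto (fun n : ℕ => SimpleGraph.binomialRandom (Fin n) (p n) {R | P n R}) atTop (𝓝 1)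

/-!
The upper bound on the threshold rests on a description of the possible separations that does not
involve the separating set. Call a set of vertices inseparable if no fewer than `k` vertices of `G`
separate two of its members. By a form of Mader's theorem (`exists_isInseparable`), every set
inducing minimum degree at least `d ≥ 4 * k` contains an inseparable set with more than `d / 2`
vertices. Take a maximal family of disjoint inseparable sets of this size, where `d` is close to
`s - 2 * k`; it has at most `O(n / s)` members. If fewer than `k` vertices `X` separate `G ⊔ R`
into sides `A` and `B`, then each member lies in `A ∪ X` or in `B ∪ X`. The members in `A ∪ X` that
meet `A` form a subfamily `J`, and closing the union of `J` under adding vertices with at least `k`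
neighbours stays within `A ∪ X`; likewise for the other members and `B ∪ X`. The two closures cover
all vertices, since the uncovered ones would induce minimum degree at least `d`
(`exists_family_of_minDegree`). Hence, for some nonempty `J` whose closure has at most `n / 2 + k`
vertices, fewer than `k` vertices cover all edges of `R` between the closure and its complement.

The closure has `Ω(s * #J)` vertices, so for a given `J` this has probability at most
`(s / n) ^ (2 * #J)` by a first moment bound (`binomialRandom_real_hasSmallCover_le`), and the sum
over all nonempty `J` is `O(s / n)`.

For the lower bounds the graph is a disjoint union of `⌊n / (s + 1)⌋` cliques of almost equal sizes,
the residue classes. With few edges added, some clique is left by fewer than `k` of them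
(`vertexConnectivity_residueCliques_sup_lt`). Below the threshold, the second moment method
(`measureReal_forall_notMem_le`) shows that some clique is left by no random edge.
-/

open MeasureTheory ProbabilityTheory

/-! ### Random edges -/

theorem measurableSet_simpleGraph {V : Type*} [Finite V] (S : Set (SimpleGraph V)) :
    MeasurableSet S := by
  rw [← Set.preimage_image_eq S SimpleGraph.edgeSet_injective]
  exact SimpleGraph.measurable_edgeSet (Set.toFinite _).measurableSet

/-- Distinct potential edges are present independently in the binomial random graph. -/
theorem binomialRandom_real_subset_disjoint {V : Type*} [Finite V] [DecidableEq V] (p : I)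
    {M F : Finset (Sym2 V)} (hM : ∀ e ∈ M, ¬ e.IsDiag) (hF : ∀ e ∈ F, ¬ e.IsDiag)
    (hMF : Disjoint M F) :
    (SimpleGraph.binomialRandom V p).real
        {R | (∀ e ∈ M, e ∈ R.edgeSet) ∧ ∀ e ∈ F, e ∉ R.edgeSet} =
      (p : ℝ) ^ M.card * (1 - (p : ℝ)) ^ F.card := by
  have hset : SimpleGraph.fromEdgeSet ⁻¹'
      {R : SimpleGraph V | (∀ e ∈ M, e ∈ R.edgeSet) ∧ ∀ e ∈ F, e ∉ R.edgeSet} =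
      {S : Set (Sym2 V) | (∀ e ∈ M, e ∈ S) ∧ ∀ e ∈ F, e ∉ S} := by
    ext S
    simp only [Set.mem_preimage, Set.mem_ofPred_eq, SimpleGraph.edgeSet_fromEdgeSet, Set.mem_sdiff]
    refine and_congr (forall₂_congr fun e he => ?_) (forall₂_congr fun e he => ?_)
    · simp [hM e he]
    · simp [hF e he]
  have hpi : (fun P : Sym2 V → Prop => {e | P e}) ⁻¹'
      {S : Set (Sym2 V) | (∀ e ∈ M, e ∈ S) ∧ ∀ e ∈ F, e ∉ S} =
      Set.pi ((M ∪ F : Finset (Sym2 V)) : Set (Sym2 V)) (fun e => {e ∈ M}) := by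
    ext P
    simp only [Set.mem_preimage, Set.mem_ofPred_eq, Set.mem_pi, Finset.coe_union,
      Set.mem_union, Finset.mem_coe, Set.mem_singleton_iff, eq_iff_iff]
    constructor
    · rintro ⟨h1, h2⟩ e (he | he)
      · exact iff_of_true (h1 e he) he
      · exact iff_of_false (h2 e he) (Finset.disjoint_right.1 hMF he)
    · intro h
      exact ⟨fun e he => (h e (Or.inl he)).2 he,
        fun e he => mt (h e (Or.inr he)).1 (Finset.disjoint_right.1 hMF he)⟩
  rw [measureReal_def, SimpleGraph.binomialRandom_eq_map,
    Measure.map_apply SimpleGraph.measurable_fromEdgeSet (measurableSet_simpleGraph _), hset,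
    setBernoulli_apply', hpi, Measure.infinitePi_pi _ (fun _ _ => MeasurableSet.of_discrete),
    Finset.prod_union hMF,
    Finset.prod_congr rfl (g := fun _ => (unitInterval.toNNReal p : ENNReal)),
    Finset.prod_congr (s₁ := F) rfl (g := fun _ => (unitInterval.toNNReal (σ p) : ENNReal))]
  · simp
  · intro e he
    have : e ∉ M := Finset.disjoint_right.1 hMF he
    simp [this, hF e he]
  · intro e he
    simp [he, hM e he]

/-- Fewer than `k` vertices meet all edges of `R` between `U` and `W`. -/
def HasSmallCover {V : Type*} (R : SimpleGraph V) (k : ℕ) (U W : Finset V) : Prop :=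
  ∃ X : Finset V, X.card < k ∧ ∀ u ∈ U, u ∉ X → ∀ w ∈ W, w ∉ X → ¬ R.Adj u w

/-- A small cover yields a small set of edges whose endpoints again cover: choose one edge at each
vertex of the cover that has one. -/
theorem HasSmallCover.exists_edges {V : Type*} [DecidableEq V] {R : SimpleGraph V} {k : ℕ}
    {U W : Finset V} (hUW : Disjoint U W) (h : HasSmallCover R k U W) :
    ∃ M ⊆ U ×ˢ W, M.card < k ∧ (∀ e ∈ M, R.Adj e.1 e.2) ∧
      ∀ u ∈ U \ M.image Prod.fst, ∀ w ∈ W \ M.image Prod.snd, ¬ R.Adj u w := by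
  classical
  obtain ⟨X, hX, hcov⟩ := h
  let Q : V → V × V → Prop := fun x e => e ∈ U ×ˢ W ∧ R.Adj e.1 e.2 ∧ (x = e.1 ∨ x = e.2)
  have hch : ∀ x : V, ∃ e : V × V, (∃ e', Q x e') → Q x e := by
    intro x
    by_cases hx : ∃ e', Q x e'
    · exact ⟨hx.choose, fun _ => hx.choose_spec⟩
    · exact ⟨(x, x), fun h => absurd h hx⟩
  choose f hf using hch
  have key : ∀ x ∈ X, ∀ e, Q x e → f x ∈ (X.filter fun x => ∃ e, Q x e).image f := fun x hx e he =>
    Finset.mem_image_of_mem f (Finset.mem_filter.2 ⟨hx, e, he⟩)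
  refine ⟨(X.filter fun x => ∃ e, Q x e).image f, ?_, ?_, ?_, ?_⟩
  · intro e he
    obtain ⟨x, hx, rfl⟩ := Finset.mem_image.1 he
    exact (hf x (Finset.mem_filter.1 hx).2).1
  · exact (Finset.card_image_le.trans (Finset.card_filter_le _ _)).trans_lt hX
  · intro e he
    obtain ⟨x, hx, rfl⟩ := Finset.mem_image.1 he
    exact (hf x (Finset.mem_filter.1 hx).2).2.1
  · intro u hu w hw huw
    rw [Finset.mem_sdiff] at hu hw
    by_cases huX : u ∈ X
    · have hQ : Q u (u, w) := ⟨Finset.mk_mem_product hu.1 hw.1, huw, Or.inl rfl⟩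
      have hfu := hf u ⟨_, hQ⟩
      rcases hfu.2.2 with h | h
      · exact hu.2 (Finset.mem_image.2 ⟨f u, key u huX _ hQ, h.symm⟩)
      · exact Finset.disjoint_left.1 hUW hu.1 (h ▸ (Finset.mem_product.1 hfu.1).2)
    · have hwX : w ∈ X := by
        by_contra hwX
        exact hcov u hu.1 huX w hw.1 hwX huw
      have hQ : Q w (u, w) := ⟨Finset.mk_mem_product hu.1 hw.1, huw, Or.inr rfl⟩
      have hfw := hf w ⟨_, hQ⟩
      rcases hfw.2.2 with h | h
      · exact Finset.disjoint_left.1 hUW (h ▸ (Finset.mem_product.1 hfw.1).1) hw.1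
      · exact hw.2 (Finset.mem_image.2 ⟨f w, key w hwX _ hQ, h.symm⟩)

theorem sym2_mk_injOn_product {V : Type*} {U W : Finset V} (hUW : Disjoint U W) :
    Set.InjOn (fun e : V × V => s(e.1, e.2)) (U ×ˢ W : Finset (V × V)) := by
  rintro ⟨a, b⟩ hab ⟨c, d⟩ hcd h
  simp only [Finset.coe_product, Set.mem_prod, Finset.mem_coe] at hab hcd
  rcases Sym2.eq_iff.1 h with ⟨rfl, rfl⟩ | ⟨rfl, rfl⟩
  · rfl
  · exact absurd hcd.2 (Finset.disjoint_left.1 hUW hab.1)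

theorem one_sub_pow_le_exp (p : I) (N : ℕ) : (1 - (p : ℝ)) ^ N ≤ Real.exp (-(p * N)) := by
  calc (1 - (p : ℝ)) ^ N ≤ (Real.exp (-p)) ^ N :=
        pow_le_pow_left₀ (sub_nonneg.2 p.2.2) (Real.one_sub_le_exp_neg _) N
    _ = Real.exp (-(p * N)) := by
        rw [← Real.exp_nat_mul]
        congr 1
        ring

/-- The probability that the edges between two disjoint sets have a cover with fewer than `k`
vertices. This is a first moment bound over the edge sets of `HasSmallCover.exists_edges`; the sum
over the possible edge sets `M` is bounded by weighting each of them with `8 ^ (k - #M) ≥ 1`. -/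
theorem binomialRandom_real_hasSmallCover_le {V : Type*} [Finite V] (p : I) {k : ℕ}
    {U W : Finset V} (hUW : Disjoint U W) (hU : 2 * k ≤ U.card) (hW : 2 * k ≤ W.card) :
    (SimpleGraph.binomialRandom V p).real {R | HasSmallCover R k U W} ≤
      8 ^ k * Real.exp (-(p * (U.card * W.card) / 8)) := by
  classical
  set N : ℝ := U.card * W.card with hN
  have hp0 : (0 : ℝ) ≤ p := p.2.1
  let S := (U ×ˢ W).powerset.filter fun M => M.card < k
  let Ev : Finset (V × V) → Set (SimpleGraph V) := fun M =>
    {R | (∀ e ∈ M.image (fun e => s(e.1, e.2)), e ∈ R.edgeSet) ∧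
      ∀ e ∈ ((U \ M.image Prod.fst) ×ˢ (W \ M.image Prod.snd)).image (fun e => s(e.1, e.2)),
        e ∉ R.edgeSet}
  have hsub : {R : SimpleGraph V | HasSmallCover R k U W} ⊆ ⋃ M ∈ S, Ev M := by
    intro R hR
    obtain ⟨M, hM, hMk, h1, h2⟩ := HasSmallCover.exists_edges hUW hR
    refine Set.mem_biUnion (x := M) (by simp [S, hM, hMk]) ⟨?_, ?_⟩
    · intro e he
      obtain ⟨a, ha, rfl⟩ := Finset.mem_image.1 he
      exact h1 a ha
    · intro e he
      obtain ⟨a, ha, rfl⟩ := Finset.mem_image.1 he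
      rw [Finset.mem_product] at ha
      exact h2 _ ha.1 _ ha.2
  have hdiag : ∀ e ∈ U ×ˢ W, ¬ (s(e.1, e.2) : Sym2 V).IsDiag := by
    intro e he h
    rw [Finset.mem_product] at he
    exact Finset.disjoint_left.1 hUW he.1 ((Sym2.mk_isDiag_iff.1 h) ▸ he.2)
  have hEv : ∀ M ∈ S, (SimpleGraph.binomialRandom V p).real (Ev M) ≤
      8 ^ k * Real.exp (-(p * N / 4)) * ((p / 8 : ℝ) ^ M.card * 1 ^ ((U ×ˢ W).card - M.card)) := by
    intro M hM
    obtain ⟨hMs, hMk⟩ := Finset.mem_filter.1 hM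
    rw [Finset.mem_powerset] at hMs
    have hFs : (U \ M.image Prod.fst) ×ˢ (W \ M.image Prod.snd) ⊆ U ×ˢ W :=
      Finset.product_subset_product Finset.sdiff_subset Finset.sdiff_subset
    rw [binomialRandom_real_subset_disjoint]
    · rw [Finset.card_image_of_injOn ((sym2_mk_injOn_product hUW).mono (by exact_mod_cast hMs)),
        Finset.card_image_of_injOn ((sym2_mk_injOn_product hUW).mono (by exact_mod_cast hFs)),
        Finset.card_product]
      have c1 : (U.card : ℝ) / 2 ≤ (U \ M.image Prod.fst).card := by
        have := Finset.le_card_sdiff (M.image Prod.fst) U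
        have := Finset.card_image_le (s := M) (f := Prod.fst)
        rw [div_le_iff₀ two_pos]
        exact_mod_cast (by omega : U.card ≤ (U \ M.image Prod.fst).card * 2)
      have c2 : (W.card : ℝ) / 2 ≤ (W \ M.image Prod.snd).card := by
        have := Finset.le_card_sdiff (M.image Prod.snd) W
        have := Finset.card_image_le (s := M) (f := Prod.snd)
        rw [div_le_iff₀ two_pos]
        exact_mod_cast (by omega : W.card ≤ (W \ M.image Prod.snd).card * 2)
      have c3 : N / 4 ≤ ((U \ M.image Prod.fst).card * (W \ M.image Prod.snd).card : ℕ) := by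
        push_cast
        calc N / 4 = (U.card : ℝ) / 2 * ((W.card : ℝ) / 2) := by rw [hN]; ring
          _ ≤ _ := mul_le_mul c1 c2 (by positivity) (by positivity)
      have e1 : (1 - (p : ℝ)) ^ ((U \ M.image Prod.fst).card * (W \ M.image Prod.snd).card) ≤
          Real.exp (-(p * N / 4)) := by
        refine (one_sub_pow_le_exp p _).trans (Real.exp_le_exp.2 ?_)
        have := mul_le_mul_of_nonneg_left c3 hp0
        linarith
      have e2 : (p : ℝ) ^ M.card ≤ 8 ^ k * (p / 8 : ℝ) ^ M.card := by
        have h8 : (p : ℝ) ^ M.card = 8 ^ M.card * (p / 8 : ℝ) ^ M.card := by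
          rw [← mul_pow]
          congr 1
          ring
        rw [h8]
        exact mul_le_mul_of_nonneg_right (pow_le_pow_right₀ (by norm_num) hMk.le) (by positivity)
      calc _ ≤ 8 ^ k * (p / 8 : ℝ) ^ M.card * Real.exp (-(p * N / 4)) :=
            mul_le_mul e2 e1 (pow_nonneg (sub_nonneg.2 p.2.2) _) (by positivity)
        _ = _ := by rw [one_pow]; ring
    · intro e he
      obtain ⟨a, ha, rfl⟩ := Finset.mem_image.1 he
      exact hdiag a (hMs ha)
    · intro e he
      obtain ⟨a, ha, rfl⟩ := Finset.mem_image.1 he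
      exact hdiag a (hFs ha)
    · rw [Finset.disjoint_left]
      intro e he he'
      obtain ⟨a, ha, rfl⟩ := Finset.mem_image.1 he
      obtain ⟨b, hb, hab⟩ := Finset.mem_image.1 he'
      have := sym2_mk_injOn_product hUW (hFs hb) (hMs ha) hab
      subst this
      exact (Finset.mem_sdiff.1 (Finset.mem_product.1 hb).1).2 (Finset.mem_image_of_mem _ ha)
  calc (SimpleGraph.binomialRandom V p).real {R | HasSmallCover R k U W}
      ≤ (SimpleGraph.binomialRandom V p).real (⋃ M ∈ S, Ev M) :=
        measureReal_mono hsub (measure_ne_top _ _)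
    _ ≤ ∑ M ∈ S, (SimpleGraph.binomialRandom V p).real (Ev M) :=
        measureReal_biUnion_finset_le _ _
    _ ≤ ∑ M ∈ S, 8 ^ k * Real.exp (-(p * N / 4)) *
          ((p / 8 : ℝ) ^ M.card * 1 ^ ((U ×ˢ W).card - M.card)) := Finset.sum_le_sum hEv
    _ ≤ ∑ M ∈ (U ×ˢ W).powerset, 8 ^ k * Real.exp (-(p * N / 4)) *
          ((p / 8 : ℝ) ^ M.card * 1 ^ ((U ×ˢ W).card - M.card)) :=
        Finset.sum_le_sum_of_subset_of_nonneg (Finset.filter_subset _ _)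
          fun _ _ _ => by positivity
    _ = 8 ^ k * Real.exp (-(p * N / 4)) * (p / 8 + 1) ^ (U.card * W.card) := by
        rw [← Finset.mul_sum, Finset.sum_pow_mul_eq_add_pow, Finset.card_product]
    _ ≤ 8 ^ k * Real.exp (-(p * N / 4)) * Real.exp (p * N / 8) := by
        refine mul_le_mul_of_nonneg_left ?_ (by positivity)
        calc (p / 8 + 1 : ℝ) ^ (U.card * W.card) ≤ (Real.exp (p / 8)) ^ (U.card * W.card) :=
              pow_le_pow_left₀ (by positivity) (Real.add_one_le_exp _) _
          _ = Real.exp (p * N / 8) := by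
              rw [← Real.exp_nat_mul, hN]
              push_cast
              congr 1
              ring
    _ = 8 ^ k * Real.exp (-(p * N / 8)) := by
        rw [mul_assoc, ← Real.exp_add]
        congr 2
        ring

/-! ### Inseparable sets -/

/-- `(X, A, B)` is a separation of `G`: the deletion of `X` leaves the nonempty vertex sets `A` and
`B` with no edge between them. -/
structure IsSeparation {V : Type*} (G : SimpleGraph V) (X A B : Finset V) : Prop where
  left_nonempty : A.Nonempty
  right_nonempty : B.Nonempty
  disjoint : Disjoint A B
  disjoint_left : Disjoint A X
  disjoint_right : Disjoint B X
  cover : ∀ v, v ∈ A ∨ v ∈ B ∨ v ∈ X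
  not_adj : ∀ a ∈ A, ∀ b ∈ B, ¬ G.Adj a b

theorem IsSeparation.symm {V : Type*} {G : SimpleGraph V} {X A B : Finset V}
    (h : IsSeparation G X A B) : IsSeparation G X B A where
  left_nonempty := h.right_nonempty
  right_nonempty := h.left_nonempty
  disjoint := h.disjoint.symm
  disjoint_left := h.disjoint_right
  disjoint_right := h.disjoint_left
  cover v := by have := h.cover v; tauto
  not_adj b hb a ha hab := h.not_adj a ha b hb hab.symm

theorem IsSeparation.anti {V : Type*} {G G' : SimpleGraph V} (hG : G ≤ G') {X A B : Finset V}
    (h : IsSeparation G' X A B) : IsSeparation G X A B :=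
  { h with not_adj := fun a ha b hb hab => h.not_adj a ha b hb (hG hab) }

theorem IsSeparation.not_isVertexConnected {V : Type*} [Fintype V] {G : SimpleGraph V}
    {X A B : Finset V} (h : IsSeparation G X A B) {k : ℕ} (hX : X.card < k) :
    ¬ IsVertexConnected G k := by
  intro hG
  obtain ⟨a, ha⟩ := h.left_nonempty
  obtain ⟨b, hb⟩ := h.right_nonempty
  have hc := (hG.2 X hX).preconnected ⟨a, Finset.disjoint_left.1 h.disjoint_left ha⟩
    ⟨b, Finset.disjoint_left.1 h.disjoint_right hb⟩
  obtain ⟨w⟩ := hc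
  have key : ∀ {x y : {v : V | v ∉ X}}, (G.induce {v : V | v ∉ X}).Walk x y →
      (x : V) ∈ A → (y : V) ∈ A := by
    intro x y w
    induction w with
    | nil => exact id
    | @cons u v _ huv _ ih =>
      intro hu
      refine ih ?_
      rcases h.cover v with hv | hv | hv
      · exact hv
      · exact absurd huv (h.not_adj _ hu _ hv)
      · exact absurd hv v.2
  exact Finset.disjoint_left.1 h.disjoint (key w ha) hb

theorem exists_isSeparation {V : Type*} [Fintype V] {G : SimpleGraph V} {k : ℕ}
    (hk : k < Fintype.card V) (h : ¬ IsVertexConnected G k) :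
    ∃ X A B : Finset V, X.card < k ∧ IsSeparation G X A B := by
  classical
  simp only [IsVertexConnected, hk, true_and, not_forall] at h
  obtain ⟨X, hX, hcon⟩ := h
  have hne : Nonempty {v : V | v ∉ X} := by
    by_contra hne
    rw [Set.nonempty_coe_sort, Set.not_nonempty_iff_eq_empty] at hne
    have : X = Finset.univ := by
      ext v
      have : v ∉ {v : V | v ∉ X} := by rw [hne]; exact Set.notMem_empty v
      simpa using this
    rw [this, Finset.card_univ] at hX
    omega
  have hpre : ¬ (G.induce {v : V | v ∉ X}).Preconnected := fun hp => hcon ⟨hp⟩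
  simp only [SimpleGraph.Preconnected, not_forall] at hpre
  obtain ⟨x, y, hxy⟩ := hpre
  let P : V → Prop := fun v => ∃ hv : v ∉ X, (G.induce {v : V | v ∉ X}).Reachable x ⟨v, hv⟩
  refine ⟨X, Finset.univ.filter P, Finset.univ.filter fun v => v ∉ X ∧ ¬ P v, hX, ?_⟩
  constructor
  · exact ⟨x, Finset.mem_filter.2 ⟨Finset.mem_univ _, x.2, .rfl⟩⟩
  · exact ⟨y, Finset.mem_filter.2 ⟨Finset.mem_univ _, y.2, fun ⟨_, h⟩ => hxy h⟩⟩
  · rw [Finset.disjoint_left]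
    intro v hv hv'
    exact (Finset.mem_filter.1 hv').2.2 (Finset.mem_filter.1 hv).2
  · rw [Finset.disjoint_left]
    intro v hv
    exact (Finset.mem_filter.1 hv).2.1
  · rw [Finset.disjoint_left]
    intro v hv
    exact (Finset.mem_filter.1 hv).2.1
  · intro v
    simp only [Finset.mem_filter, Finset.mem_univ, true_and]
    tauto
  · intro a ha b hb hab
    obtain ⟨haX, har⟩ := (Finset.mem_filter.1 ha).2
    obtain ⟨hbX, hbr⟩ := (Finset.mem_filter.1 hb).2
    refine hbr ⟨hbX, har.trans (SimpleGraph.Adj.reachable ?_)⟩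
    exact hab

/-- No fewer than `k` vertices of `G` separate two vertices of `T`. Paths in `G` may leave `T`, so
this is weaker than `k`-connectedness of `G[T]`. -/
def IsInseparable {V : Type*} (G : SimpleGraph V) (k : ℕ) (T : Finset V) : Prop :=
  ∀ X A B : Finset V, X.card < k → IsSeparation G X A B → Disjoint T A ∨ Disjoint T B

/-- The ordered pairs of adjacent vertices of `T`, that is, the darts of `G[T]`. -/
def innerDarts {V : Type*} (G : SimpleGraph V) [DecidableRel G.Adj] (T : Finset V) :
    Finset (V × V) :=
  (T ×ˢ T).filter fun e => G.Adj e.1 e.2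

section Mader

variable {V : Type*} (G : SimpleGraph V) [DecidableRel G.Adj]

theorem mul_card_le_card_innerDarts [DecidableEq V] {d : ℕ} {S : Finset V}
    (h : ∀ v ∈ S, d ≤ (S.filter (G.Adj v)).card) : d * S.card ≤ (innerDarts G S).card := by
  rw [Finset.card_eq_sum_card_fiberwise (f := Prod.fst) (t := S)]
  · rw [mul_comm, ← smul_eq_mul]
    refine Finset.card_nsmul_le_sum _ _ _ fun v hv => (h v hv).trans ?_
    rw [← Finset.card_image_of_injective (S.filter (G.Adj v)) (Prod.mk_right_injective v)]
    refine Finset.card_le_card fun e he => ?_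
    obtain ⟨w, hw, rfl⟩ := Finset.mem_image.1 he
    rw [Finset.mem_filter] at hw
    simp [innerDarts, hv, hw.1, hw.2]
  · intro e he
    simp only [innerDarts, Finset.coe_filter, Finset.mem_product, Set.mem_ofPred_eq] at he
    exact he.1.1

theorem card_innerDarts_le_erase [DecidableEq V] (T : Finset V) (v : V) :
    (innerDarts G T).card ≤
      (innerDarts G (T.erase v)).card + 2 * (T.filter (G.Adj v)).card := by
  have hsub : innerDarts G T ⊆ innerDarts G (T.erase v) ∪
      ((T.filter (G.Adj v)).image (fun w => (v, w)) ∪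
        (T.filter (G.Adj v)).image (fun w => (w, v))) := by
    rintro ⟨a, b⟩ he
    simp only [innerDarts, Finset.mem_filter, Finset.mem_product] at he
    simp only [innerDarts, Finset.mem_union, Finset.mem_filter, Finset.mem_product,
      Finset.mem_erase, Finset.mem_image, Prod.mk.injEq]
    by_cases ha : a = v
    · subst ha
      exact Or.inr (Or.inl ⟨b, ⟨he.1.2, he.2⟩, rfl, rfl⟩)
    by_cases hb : b = v
    · subst hb
      exact Or.inr (Or.inr ⟨a, ⟨he.1.1, he.2.symm⟩, rfl, rfl⟩)
    exact Or.inl ⟨⟨⟨ha, he.1.1⟩, hb, he.1.2⟩, he.2⟩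
  have := Finset.card_le_card hsub
  have := Finset.card_union_le (innerDarts G (T.erase v))
    ((T.filter (G.Adj v)).image (fun w => (v, w)) ∪ (T.filter (G.Adj v)).image (fun w => (w, v)))
  have := Finset.card_union_le ((T.filter (G.Adj v)).image (fun w => (v, w)))
    ((T.filter (G.Adj v)).image (fun w => (w, v)))
  have := Finset.card_image_le (s := T.filter (G.Adj v)) (f := fun w => (v, w))
  have := Finset.card_image_le (s := T.filter (G.Adj v)) (f := fun w => (w, v))
  omega

theorem card_innerDarts_le_card_mul_pred (T : Finset V) :
    (innerDarts G T).card ≤ T.card * T.card - T.card := by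
  rw [← Finset.offDiag_card]
  refine Finset.card_le_card fun e he => ?_
  simp only [innerDarts, Finset.mem_filter, Finset.mem_product] at he
  exact Finset.mem_offDiag.2 ⟨he.1.1, he.1.2, he.2.ne⟩

/-- A form of Mader's theorem: a set of vertices inducing minimum degree at least `d ≥ 4 * k`
contains an inseparable set with more than `d / 2` vertices. As in Mader's proof, the set is a
smallest `T` with at least `2 * k` vertices and average degree above `d * (1 - k / #T)`: if a
small `X` separated `T`, one of the two sides together with `X` would satisfy the same bounds. -/
theorem exists_isInseparable {k d : ℕ} (hk : 0 < k) (hd : 4 * k ≤ d) {S : Finset V}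
    (hS : S.Nonempty) (h : ∀ v ∈ S, d ≤ (S.filter (G.Adj v)).card) :
    ∃ T ⊆ S, d < 2 * T.card ∧ IsInseparable G k T := by
  classical
  let Q : Finset V → Prop := fun T =>
    2 * k ≤ T.card ∧ d * T.card < (innerDarts G T).card + d * k
  have hQS : Q S := by
    obtain ⟨v, hv⟩ := hS
    have h1 := (h v hv).trans (Finset.card_filter_le _ _)
    refine ⟨by omega, ?_⟩
    have := mul_card_le_card_innerDarts G h
    have : 0 < d * k := Nat.mul_pos (by omega) hk
    omega
  obtain ⟨T, hTm, hmin⟩ := Finset.exists_min_image (S.powerset.filter Q) Finset.card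
    ⟨S, by simp [hQS]⟩
  rw [Finset.mem_filter, Finset.mem_powerset] at hTm
  obtain ⟨hTS, hT2k, hTd⟩ := hTm
  have hmin' : ∀ T' ⊆ T, T'.card < T.card → 2 * k ≤ T'.card →
      (innerDarts G T').card + d * k ≤ d * T'.card := by
    intro T' hT' hlt h2k
    by_contra hcon
    have := hmin T' (Finset.mem_filter.2
      ⟨Finset.mem_powerset.2 (hT'.trans hTS), h2k, not_le.1 hcon⟩)
    omega
  have hTgt : 2 * k < T.card := by
    refine lt_of_le_of_ne hT2k fun heq => ?_
    have h1 := card_innerDarts_le_card_mul_pred G T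
    rw [← heq] at h1 hTd
    have h2 : 4 * k * k ≤ d * k := Nat.mul_le_mul_right k hd
    have h3 : d * (2 * k) = d * k + d * k := by ring
    have h4 : 2 * k * (2 * k) = 4 * k * k := by ring
    omega
  have hdeg : ∀ v ∈ T, d < 2 * (T.filter (G.Adj v)).card := by
    intro v hv
    by_contra hcon
    have hc := Finset.card_erase_of_mem hv
    have h1 := hmin' (T.erase v) (Finset.erase_subset _ _) (by omega) (by omega)
    have h2 := card_innerDarts_le_erase G T v
    have h3 : d * T.card = d * (T.erase v).card + d := by
      rw [hc, ← Nat.mul_succ]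
      congr 1
      omega
    omega
  refine ⟨T, hTS, ?_, ?_⟩
  · obtain ⟨v, hv⟩ : T.Nonempty := Finset.card_pos.1 (by omega)
    have := hdeg v hv
    have := Finset.card_filter_le T (G.Adj v)
    omega
  · intro X A B hX hsep
    by_contra hcon
    rw [not_or, Finset.not_disjoint_iff, Finset.not_disjoint_iff] at hcon
    obtain ⟨⟨a, haT, haA⟩, b, hbT, hbB⟩ := hcon
    have side : ∀ {A B : Finset V}, IsSeparation G X A B → ∀ a ∈ T, a ∈ A → ∀ b ∈ T, b ∈ B →
        (innerDarts G (T ∩ (A ∪ X))).card + d * k ≤ d * (T ∩ (A ∪ X)).card := by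
      intro A B hsep a haT haA b hbT hbB
      refine hmin' _ Finset.inter_subset_left (Finset.card_lt_card ?_) ?_
      · refine Finset.ssubset_iff_subset_ne.2 ⟨Finset.inter_subset_left, fun heq => ?_⟩
        rw [← heq, Finset.mem_inter, Finset.mem_union] at hbT
        rcases hbT.2 with hb | hb
        · exact Finset.disjoint_left.1 hsep.disjoint hb hbB
        · exact Finset.disjoint_left.1 hsep.disjoint_right hbB hb
      · have hsub : T.filter (G.Adj a) ⊆ T ∩ (A ∪ X) := by
          intro w hw
          rw [Finset.mem_filter] at hw
          rw [Finset.mem_inter, Finset.mem_union]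
          refine ⟨hw.1, ?_⟩
          rcases hsep.cover w with h | h | h
          · exact Or.inl h
          · exact absurd hw.2 (hsep.not_adj a haA w h)
          · exact Or.inr h
        have := Finset.card_le_card hsub
        have := hdeg a haT
        omega
    have h1 := side hsep a haT haA b hbT hbB
    have h2 := side hsep.symm b hbT hbB a haT haA
    have hdarts : innerDarts G T ⊆ innerDarts G (T ∩ (A ∪ X)) ∪ innerDarts G (T ∩ (B ∪ X)) := by
      rintro ⟨u, v⟩ he
      simp only [innerDarts, Finset.mem_filter, Finset.mem_product] at he
      simp only [innerDarts, Finset.mem_union, Finset.mem_filter, Finset.mem_product,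
        Finset.mem_inter]
      have hu := hsep.cover u
      have hv := hsep.cover v
      have huv : ¬ (u ∈ A ∧ v ∈ B) := fun h => hsep.not_adj u h.1 v h.2 he.2
      have hvu : ¬ (v ∈ A ∧ u ∈ B) := fun h => hsep.not_adj v h.1 u h.2 he.2.symm
      have := he.1.1
      have := he.1.2
      have := he.2
      tauto
    have h3 := (Finset.card_le_card hdarts).trans (Finset.card_union_le _ _)
    have h4 := Finset.card_union_add_card_inter (T ∩ (A ∪ X)) (T ∩ (B ∪ X))
    have h5 : (T ∩ (A ∪ X) ∪ T ∩ (B ∪ X)).card ≤ T.card :=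
      Finset.card_le_card (Finset.union_subset Finset.inter_subset_left Finset.inter_subset_left)
    have h6 : (T ∩ (A ∪ X) ∩ (T ∩ (B ∪ X))).card ≤ X.card := by
      refine Finset.card_le_card fun v hv => ?_
      simp only [Finset.mem_inter, Finset.mem_union] at hv
      have : v ∈ A → v ∉ B := fun h => Finset.disjoint_left.1 hsep.disjoint h
      tauto
    have h7 : d * ((T ∩ (A ∪ X)).card + (T ∩ (B ∪ X)).card) ≤ d * (T.card + k) :=
      Nat.mul_le_mul_left d (by omega)
    rw [Nat.mul_add, Nat.mul_add] at h7
    omega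

end Mader

/-! ### Separations of a perturbed graph -/

section Closure

variable {V : Type*} [Fintype V] (G : SimpleGraph V) [DecidableRel G.Adj] (k : ℕ)

/-- The smallest set containing `U` and every vertex with at least `k` neighbours in the set. -/
noncomputable def attachClosure (U : Finset V) : Finset V :=
  (Set.toFinite {v | ∀ Z : Finset V, U ⊆ Z →
    (∀ w, k ≤ (Z.filter (G.Adj w)).card → w ∈ Z) → v ∈ Z}).toFinset

theorem subset_attachClosure (U : Finset V) : U ⊆ attachClosure G k U := fun _ hv =>
  (Set.Finite.mem_toFinset _).2 fun _ hUZ _ => hUZ hv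

theorem attachClosure_subset {U Z : Finset V} (hUZ : U ⊆ Z)
    (hZ : ∀ w, k ≤ (Z.filter (G.Adj w)).card → w ∈ Z) : attachClosure G k U ⊆ Z := fun _ hv =>
  (Set.Finite.mem_toFinset _).1 hv Z hUZ hZ

theorem mem_attachClosure_of_le {U : Finset V} {w : V}
    (hw : k ≤ ((attachClosure G k U).filter (G.Adj w)).card) : w ∈ attachClosure G k U :=
  (Set.Finite.mem_toFinset _).2 fun _ hUZ hZ => hZ w (hw.trans (Finset.card_le_card
    (Finset.filter_subset_filter _ (attachClosure_subset G k hUZ hZ))))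

/-- A vertex with `k > #X` neighbours in `A ∪ X` has a neighbour in `A`, so it is not in `B`. -/
theorem IsSeparation.attachClosure_subset [DecidableEq V] {G : SimpleGraph V}
    [DecidableRel G.Adj] {k : ℕ} {X A B U : Finset V} (h : IsSeparation G X A B)
    (hX : X.card < k) (hU : U ⊆ A ∪ X) : attachClosure G k U ⊆ A ∪ X := by
  refine _root_.attachClosure_subset G k hU fun w hw => ?_
  obtain ⟨a, ha, haX⟩ := Finset.exists_mem_notMem_of_card_lt_card (hX.trans_le hw)
  rw [Finset.mem_filter, Finset.mem_union] at ha
  have haA := ha.1.resolve_right haX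
  rw [Finset.mem_union]
  rcases h.cover w with hw | hw | hw
  · exact Or.inl hw
  · exact absurd ha.2.symm (h.not_adj a haA w hw)
  · exact Or.inr hw

end Closure

/-- The deterministic part of the upper bound. Take a maximal family `P` of disjoint inseparable
sets of linear size in `s`. Whenever `G ⊔ R` is not `k`-connected, the sets of `P` divide into
those meeting one side of the separation and the others, and the closures of the two parts cover
all vertices. So the place of the separation is determined, up to fewer than `k` vertices, by a
subfamily `J`, and there are few subfamilies. -/
theorem exists_family_of_minDegree {V : Type*} [Fintype V] [DecidableEq V] (G : SimpleGraph V)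
    [DecidableRel G.Adj] {k s : ℕ} (hk : 0 < k) (hks : 17 * k ≤ s)
    (hdeg : ∀ v, s ≤ (Finset.univ.filter (G.Adj v)).card) (hkV : k < Fintype.card V) :
    ∃ (P : Finset (Finset V)) (cl : Finset (Finset V) → Finset V),
      (∀ J ⊆ P, 15 * s * J.card ≤ 34 * (cl J).card) ∧
      ∀ R : SimpleGraph V, ¬ IsVertexConnected (G ⊔ R) k →
        ∃ J ⊆ P, J.Nonempty ∧ 2 * (cl J).card ≤ Fintype.card V + 2 * k ∧
          HasSmallCover R k (cl J) (cl J)ᶜ := by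
  classical
  obtain ⟨d, hd⟩ : ∃ d, s + 2 = d + 2 * k := ⟨s + 2 - 2 * k, by omega⟩
  let Q : Finset (Finset V) → Prop := fun P =>
    (P : Set (Finset V)).PairwiseDisjoint id ∧ ∀ T ∈ P, d < 2 * T.card ∧ IsInseparable G k T
  obtain ⟨P, hP, hmax⟩ := Finset.exists_max_image (Finset.univ.filter Q) Finset.card
    ⟨∅, by simp [Q]⟩
  obtain ⟨hdisj, hT⟩ := (Finset.mem_filter.1 hP).2
  -- By maximality the vertices outside the family induce no subgraph of minimum degree `d`.
  have hsparse : ∀ S : Finset V, (∀ v ∈ S, ∀ T ∈ P, v ∉ T) →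
      (∀ v ∈ S, d ≤ (S.filter (G.Adj v)).card) → S = ∅ := by
    intro S hSP hS
    by_contra hne
    obtain ⟨T, hTS, hTd, hTi⟩ := exists_isInseparable G hk (by omega)
      (Finset.nonempty_iff_ne_empty.2 hne) hS
    have hTdisj : ∀ T' ∈ P, Disjoint T T' := fun T' hT' =>
      Finset.disjoint_left.2 fun v hv => hSP v (hTS hv) T' hT'
    have hTn : T ∉ P := by
      intro hTm
      have := Finset.disjoint_self_iff_empty _ |>.1 (hTdisj T hTm)
      simp [this] at hTd
    have hQ : Q (insert T P) := by
      refine ⟨?_, ?_⟩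
      · rw [Finset.coe_insert]
        exact hdisj.insert fun T' hT' _ => hTdisj T' hT'
      · intro T' hT'
        rcases Finset.mem_insert.1 hT' with rfl | h
        · exact ⟨hTd, hTi⟩
        · exact hT T' h
    have := hmax (insert T P) (Finset.mem_filter.2 ⟨Finset.mem_univ _, hQ⟩)
    rw [Finset.card_insert_of_notMem hTn] at this
    omega
  let cl : Finset (Finset V) → Finset V := fun J => attachClosure G k (J.biUnion id)
  have hmem_cl : ∀ J : Finset (Finset V), ∀ T ∈ J, T ⊆ cl J := fun J T hTJ =>
    (Finset.subset_biUnion_of_mem id hTJ).trans (subset_attachClosure G k _)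
  have hcover : ∀ J ⊆ P, ∀ v, v ∈ cl J ∨ v ∈ cl (P \ J) := by
    intro J hJ v
    by_contra hv
    have hS : Finset.univ.filter (fun v => ¬ (v ∈ cl J ∨ v ∈ cl (P \ J))) = ∅ := by
      refine hsparse _ ?_ ?_
      · intro w hw T hTP hwT
        refine (Finset.mem_filter.1 hw).2 ?_
        by_cases hTJ : T ∈ J
        · exact Or.inl (hmem_cl J T hTJ hwT)
        · exact Or.inr (hmem_cl _ T (Finset.mem_sdiff.2 ⟨hTP, hTJ⟩) hwT)
      · intro w hw
        have hw' := (Finset.mem_filter.1 hw).2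
        rw [not_or] at hw'
        have h1 : ((cl J).filter (G.Adj w)).card < k := by
          by_contra h
          exact hw'.1 (mem_attachClosure_of_le G k (not_lt.1 h))
        have h2 : ((cl (P \ J)).filter (G.Adj w)).card < k := by
          by_contra h
          exact hw'.2 (mem_attachClosure_of_le G k (not_lt.1 h))
        have hsub : Finset.univ.filter (G.Adj w) ⊆ ((cl J).filter (G.Adj w) ∪
            (cl (P \ J)).filter (G.Adj w)) ∪
            (Finset.univ.filter (fun v => ¬ (v ∈ cl J ∨ v ∈ cl (P \ J)))).filter (G.Adj w) := by
          intro x hx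
          simp only [Finset.mem_filter, Finset.mem_union, Finset.mem_univ, true_and] at hx ⊢
          tauto
        have h3 := (Finset.card_le_card hsub).trans (Finset.card_union_le _ _)
        have h4 := Finset.card_union_le ((cl J).filter (G.Adj w)) ((cl (P \ J)).filter (G.Adj w))
        have h5 := hdeg w
        omega
    have : v ∈ Finset.univ.filter (fun v => ¬ (v ∈ cl J ∨ v ∈ cl (P \ J))) :=
      Finset.mem_filter.2 ⟨Finset.mem_univ v, hv⟩
    rw [hS] at this
    exact Finset.notMem_empty v this
  refine ⟨P, cl, ?_, ?_⟩
  · intro J hJ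
    have h1 : J.card * (d + 1) ≤ 2 * (J.biUnion id).card := by
      rw [Finset.card_biUnion fun T hT T' hT' hne => hdisj (hJ hT) (hJ hT') hne, Finset.mul_sum,
        ← smul_eq_mul]
      exact Finset.card_nsmul_le_sum _ _ _ fun T hTJ => (hT T (hJ hTJ)).1
    have h2 := Finset.card_le_card (subset_attachClosure G k (J.biUnion id))
    have h3 : 15 * s * J.card ≤ 17 * (J.card * (d + 1)) := by
      have : 15 * s ≤ 17 * (d + 1) := by omega
      calc 15 * s * J.card ≤ 17 * (d + 1) * J.card := Nat.mul_le_mul_right _ this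
        _ = _ := by ring
    change 15 * s * J.card ≤ 34 * (attachClosure G k (J.biUnion id)).card
    omega
  · intro R hR
    obtain ⟨X, A, B, hX, hsep⟩ := exists_isSeparation hkV hR
    have hsepG := hsep.anti (le_sup_left : G ≤ G ⊔ R)
    -- A side of the separation that contains no member of the family outside `X` would be sparse.
    have hmeet : ∀ {A B : Finset V}, IsSeparation G X A B → ∃ T ∈ P, ¬ Disjoint T A := by
      intro A B hsep
      by_contra hcon
      push Not at hcon
      refine hsep.left_nonempty.ne_empty (hsparse A (fun v hv T hTP hvT =>
        Finset.disjoint_left.1 (hcon T hTP) hvT hv) fun v hv => ?_)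
      have hsub : Finset.univ.filter (G.Adj v) ⊆ A.filter (G.Adj v) ∪ X := by
        intro x hx
        have hx := (Finset.mem_filter.1 hx).2
        rw [Finset.mem_union, Finset.mem_filter]
        rcases hsep.cover x with h | h | h
        · exact Or.inl ⟨h, hx⟩
        · exact absurd hx (hsep.not_adj v hv x h)
        · exact Or.inr h
      have h1 := (Finset.card_le_card hsub).trans (Finset.card_union_le _ _)
      have h2 := hdeg v
      omega
    have hside : ∀ {A B : Finset V}, IsSeparation G X A B → ∀ T, Disjoint T B → T ⊆ A ∪ X := by
      intro A B hsep T hTB v hv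
      rw [Finset.mem_union]
      rcases hsep.cover v with h | h | h
      · exact Or.inl h
      · exact absurd h (Finset.disjoint_left.1 hTB hv)
      · exact Or.inr h
    have hfinish : ∀ {A B : Finset V}, IsSeparation (G ⊔ R) X A B → ∀ J ⊆ P, J.Nonempty →
        cl J ⊆ A ∪ X → cl (P \ J) ⊆ B ∪ X → (cl J).card ≤ (cl (P \ J)).card →
        ∃ J ⊆ P, J.Nonempty ∧ 2 * (cl J).card ≤ Fintype.card V + 2 * k ∧
          HasSmallCover R k (cl J) (cl J)ᶜ := by
      intro A B hsep J hJ hne hJA hJB hle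
      refine ⟨J, hJ, hne, ?_, X, hX, ?_⟩
      · have h1 := Finset.card_union_add_card_inter (cl J) (cl (P \ J))
        have h2 := Finset.card_le_univ (cl J ∪ cl (P \ J))
        have h3 : (cl J ∩ cl (P \ J)).card ≤ X.card := by
          refine Finset.card_le_card fun v hv => ?_
          rw [Finset.mem_inter] at hv
          have hA := Finset.mem_union.1 (hJA hv.1)
          have hB := Finset.mem_union.1 (hJB hv.2)
          have : v ∈ A → v ∉ B := fun h => Finset.disjoint_left.1 hsep.disjoint h
          tauto
        omega
      · intro u hu huX w hw hwX huw
        have huA := (Finset.mem_union.1 (hJA hu)).resolve_right huX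
        have hwB := (Finset.mem_union.1
          (hJB ((hcover J hJ w).resolve_left (Finset.mem_compl.1 hw)))).resolve_right hwX
        exact hsep.not_adj u huA w hwB (Or.inr huw)
    let J := P.filter fun T => ¬ Disjoint T A
    have hJ : J ⊆ P := Finset.filter_subset _ _
    have hJA : cl J ⊆ A ∪ X := by
      refine hsepG.attachClosure_subset hX (Finset.biUnion_subset.2 fun T hTJ => ?_)
      obtain ⟨hTP, hTA⟩ := Finset.mem_filter.1 hTJ
      exact hside hsepG T (((hT T hTP).2 X A B hX hsepG).resolve_left hTA)
    have hJB : cl (P \ J) ⊆ B ∪ X := by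
      refine hsepG.symm.attachClosure_subset hX (Finset.biUnion_subset.2 fun T hTJ => ?_)
      obtain ⟨hTP, hTn⟩ := Finset.mem_sdiff.1 hTJ
      refine hside hsepG.symm T ?_
      by_contra hTA
      exact hTn (Finset.mem_filter.2 ⟨hTP, hTA⟩)
    rcases le_total (cl J).card (cl (P \ J)).card with hle | hle
    · obtain ⟨T, hTP, hTA⟩ := hmeet hsepG
      exact hfinish hsep J hJ ⟨T, Finset.mem_filter.2 ⟨hTP, hTA⟩⟩ hJA hJB hle
    · have hJJ : P \ (P \ J) = J := Finset.sdiff_sdiff_eq_self hJ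
      obtain ⟨T, hTP, hTB⟩ := hmeet hsepG.symm
      have hTJ : T ∉ J := fun h => hTB
        (((hT T hTP).2 X A B hX hsepG).resolve_left (Finset.mem_filter.1 h).2)
      exact hfinish hsep.symm (P \ J) Finset.sdiff_subset ⟨T, Finset.mem_sdiff.2 ⟨hTP, hTJ⟩⟩ hJB
        (by rw [hJJ]; exact hJA) (by rw [hJJ]; exact hle)

/-- The quantitative form of the upper bound, by a union bound over the subfamilies `J`. -/
theorem binomialRandom_real_not_isVertexConnected_le {V : Type*} [Fintype V] (G : SimpleGraph V)
    [DecidableRel G.Adj] {k s : ℕ} (hk : 0 < k) (hks : 17 * k ≤ s) (hsV : s ≤ Fintype.card V)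
    (hdeg : ∀ v, s ≤ (Finset.univ.filter (G.Adj v)).card) (p : I)
    (hp : 1088 * ((k : ℝ) + Real.log ((Fintype.card V : ℝ) / s)) ≤ p * (Fintype.card V * s)) :
    (SimpleGraph.binomialRandom V p).real {R | ¬ IsVertexConnected (G ⊔ R) k} ≤
      Real.exp (3 * ((s : ℝ) / Fintype.card V)) - 1 := by
  classical
  set n := Fintype.card V with hn
  obtain ⟨P, cl, hcl, hR⟩ := exists_family_of_minDegree G hk hks hdeg (by omega)
  have hs0 : (0 : ℝ) < s := by exact_mod_cast (by omega : 0 < s)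
  have hn0 : (0 : ℝ) < n := by exact_mod_cast (by omega : 0 < n)
  have hk0 : (0 : ℝ) < k := by exact_mod_cast hk
  have hp0 : (0 : ℝ) ≤ p := p.2.1
  set L := Real.log ((n : ℝ) / s) with hL
  have hL0 : 0 ≤ L := Real.log_nonneg ((one_le_div hs0).2 (by exact_mod_cast hsV))
  set x : ℝ := ((s : ℝ) / n) ^ 2 with hx
  have hxL : x = Real.exp (-(2 * L)) := by
    rw [hx, hL, ← inv_div, Real.exp_neg, inv_pow, two_mul, Real.exp_add,
      Real.exp_log (by positivity), sq]
  let S := (P.powerset.erase ∅).filter fun J => 2 * (cl J).card ≤ n + 2 * k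
  have hbound : ∀ J ∈ S, (SimpleGraph.binomialRandom V p).real
      {R | HasSmallCover R k (cl J) (cl J)ᶜ} ≤ x ^ J.card * 1 ^ (P.card - J.card) := by
    intro J hJ
    obtain ⟨hJP, hJn⟩ := Finset.mem_filter.1 hJ
    rw [Finset.mem_erase, Finset.mem_powerset] at hJP
    have hJ1 : 1 ≤ J.card := Finset.card_pos.2 (Finset.nonempty_iff_ne_empty.2 hJP.1)
    have hU := hcl J hJP.2
    have hsJ : s * 1 ≤ s * J.card := Nat.mul_le_mul_left s hJ1
    have hUW : (cl J)ᶜ.card + (cl J).card = n := Finset.card_compl_add_card _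
    have hW : n ≤ 4 * (cl J)ᶜ.card := by omega
    refine (binomialRandom_real_hasSmallCover_le p disjoint_compl_right
      (by rw [mul_assoc] at hU; omega) (by omega)).trans ?_
    have hJ1' : (1 : ℝ) ≤ J.card := by exact_mod_cast hJ1
    have hUr : (15 / 34 : ℝ) * s * J.card ≤ (cl J).card := by
      have : (15 * s * J.card : ℝ) ≤ 34 * (cl J).card := by exact_mod_cast hU
      linarith
    have hWr : (n : ℝ) / 4 ≤ (cl J)ᶜ.card := by
      have : (n : ℝ) ≤ 4 * (cl J)ᶜ.card := by exact_mod_cast hW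
      linarith
    have hprod : (15 / 34 : ℝ) * s * J.card * (n / 4) ≤ (cl J).card * (cl J)ᶜ.card :=
      mul_le_mul hUr hWr (by positivity) (by positivity)
    have hexp : 15 * J.card * (k + L) ≤ p * ((cl J).card * (cl J)ᶜ.card) / 8 := by
      have h1 := mul_le_mul_of_nonneg_left hprod hp0
      have h2 := mul_le_mul_of_nonneg_left hp (by positivity : (0 : ℝ) ≤ 15 / 1088 * J.card)
      linarith
    have h8 : (8 : ℝ) ^ k ≤ Real.exp (3 * k) := by
      have : (8 : ℝ) ≤ Real.exp 3 := by
        have h2 : (2 : ℝ) ≤ Real.exp 1 := by linarith [Real.add_one_le_exp (1 : ℝ)]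
        calc (8 : ℝ) = 2 ^ 3 := by norm_num
          _ ≤ Real.exp 1 ^ 3 := pow_le_pow_left₀ (by norm_num) h2 3
          _ = Real.exp 3 := by rw [← Real.exp_nat_mul]; norm_num
      calc (8 : ℝ) ^ k ≤ Real.exp 3 ^ k := pow_le_pow_left₀ (by norm_num) this k
        _ = Real.exp (3 * k) := by rw [← Real.exp_nat_mul]; ring_nf
    calc (8 : ℝ) ^ k * Real.exp (-(p * ((cl J).card * (cl J)ᶜ.card) / 8))
        ≤ Real.exp (3 * k) * Real.exp (-(15 * J.card * (k + L))) :=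
          mul_le_mul h8 (Real.exp_le_exp.2 (by linarith)) (by positivity) (by positivity)
      _ ≤ Real.exp (J.card * (-(2 * L))) := by
          rw [← Real.exp_add]
          refine Real.exp_le_exp.2 ?_
          have h1 : (k : ℝ) * 1 ≤ k * J.card := mul_le_mul_of_nonneg_left hJ1' hk0.le
          have h2 : 0 ≤ J.card * L := by positivity
          linarith
      _ = x ^ J.card * 1 ^ (P.card - J.card) := by rw [one_pow, mul_one, Real.exp_nat_mul, hxL]
  have hsub : {R : SimpleGraph V | ¬ IsVertexConnected (G ⊔ R) k} ⊆
      ⋃ J ∈ S, {R | HasSmallCover R k (cl J) (cl J)ᶜ} := by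
    intro R hRn
    obtain ⟨J, hJ, hne, hJn, hcov⟩ := hR R hRn
    exact Set.mem_biUnion (x := J) (Finset.mem_coe.2 (Finset.mem_filter.2
      ⟨Finset.mem_erase.2 ⟨hne.ne_empty, Finset.mem_powerset.2 hJ⟩, hJn⟩)) hcov
  have hm : x * P.card ≤ 3 * ((s : ℝ) / n) := by
    have h1 := hcl P subset_rfl
    have h2 := Finset.card_le_univ (cl P)
    have h3 : (15 * s * P.card : ℝ) ≤ 34 * n := by
      exact_mod_cast h1.trans (Nat.mul_le_mul_left 34 h2)
    have h4 : (s : ℝ) / n * (s * P.card) ≤ s / n * (3 * n) :=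
      mul_le_mul_of_nonneg_left (by linarith) (by positivity)
    rw [hx]
    calc ((s : ℝ) / n) ^ 2 * P.card = s / n * (s * P.card) / n := by field_simp
      _ ≤ s / n * (3 * n) / n := by gcongr
      _ = 3 * ((s : ℝ) / n) := by field_simp
  calc (SimpleGraph.binomialRandom V p).real {R | ¬ IsVertexConnected (G ⊔ R) k}
      ≤ (SimpleGraph.binomialRandom V p).real
          (⋃ J ∈ S, {R | HasSmallCover R k (cl J) (cl J)ᶜ}) :=
        measureReal_mono hsub (measure_ne_top _ _)
    _ ≤ ∑ J ∈ S, (SimpleGraph.binomialRandom V p).real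
          {R | HasSmallCover R k (cl J) (cl J)ᶜ} := measureReal_biUnion_finset_le _ _
    _ ≤ ∑ J ∈ S, x ^ J.card * 1 ^ (P.card - J.card) := Finset.sum_le_sum hbound
    _ ≤ ∑ J ∈ P.powerset.erase ∅, x ^ J.card * 1 ^ (P.card - J.card) :=
        Finset.sum_le_sum_of_subset_of_nonneg (Finset.filter_subset _ _)
          fun _ _ _ => by positivity
    _ = (x + 1) ^ P.card - 1 := by
        rw [← Finset.sum_pow_mul_eq_add_pow, ← Finset.add_sum_erase _ _
          (Finset.empty_mem_powerset P)]
        simp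
    _ ≤ Real.exp (3 * ((s : ℝ) / n)) - 1 := by
        refine sub_le_sub_right ?_ 1
        calc (x + 1) ^ P.card ≤ Real.exp x ^ P.card :=
              pow_le_pow_left₀ (by positivity) (Real.add_one_le_exp x) _
          _ = Real.exp (x * P.card) := by rw [← Real.exp_nat_mul, mul_comm]
          _ ≤ _ := Real.exp_le_exp.2 hm

theorem aas_of_real_compl_le {p : ℕ → I} {P : ∀ n : ℕ, SimpleGraph (Fin n) → Prop} {b : ℕ → ℝ}
    (hb : Tendsto b atTop (𝓝 0))
    (h : ∀ᶠ n : ℕ in atTop,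
      (SimpleGraph.binomialRandom (Fin n) (p n)).real {R | ¬ P n R} ≤ b n) :
    AAS p P := by
  unfold AAS
  rw [← ENNReal.tendsto_toReal_iff (fun n => measure_ne_top _ _) ENNReal.one_ne_top,
    ENNReal.toReal_one]
  have h0 : Tendsto (fun n => 1 - (SimpleGraph.binomialRandom (Fin n) (p n)).real {R | ¬ P n R})
      atTop (𝓝 (1 - 0)) :=
    tendsto_const_nhds.sub (squeeze_zero' (.of_forall fun n => measureReal_nonneg) h hb)
  rw [sub_zero] at h0
  refine h0.congr fun n => ?_
  rw [← probReal_compl_eq_one_sub (measurableSet_simpleGraph _)]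
  congr 1
  ext R
  simp

theorem card_filter_adj_ge_of_le_minDeg {V : Type*} [Fintype V] (G : SimpleGraph V)
    [DecidableRel G.Adj] {s : ℕ} (h : s ≤ minDeg G) (v : V) :
    s ≤ (Finset.univ.filter (G.Adj v)).card := by
  classical
  refine (h.trans (@SimpleGraph.minDegree_le_degree V G _ (Classical.decRel G.Adj) v)).trans ?_
  rw [← SimpleGraph.card_neighborFinset_eq_degree]
  refine Finset.card_le_card fun w hw => ?_
  simpa using hw

theorem aas_le_vertexConnectivity {c : ℝ} (hc : 1088 ≤ c) {k s : ℕ → ℕ} (hk : ∀ n, 0 < k n)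
    (hs : ∀ n, 0 < s n) (hks : ∀ n, (k n : ℝ) ≤ (s n : ℝ) / 17)
    (hsn : (fun n => (s n : ℝ)) =o[atTop] (fun n : ℕ => (n : ℝ)))
    {G : ∀ n : ℕ, SimpleGraph (Fin n)} (hG : ∀ᶠ n in atTop, minDeg (G n) = s n) {p : ℕ → I}
    (hp : ∀ᶠ n : ℕ in atTop,
      c * ((k n : ℝ) + Real.log ((n : ℝ) / (s n : ℝ))) / ((n : ℝ) * (s n : ℝ)) ≤ (p n : ℝ)) :
    AAS p (fun n R => k n ≤ vertexConnectivity (G n ⊔ R)) := by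
  classical
  have hlim : Tendsto (fun n : ℕ => Real.exp (3 * ((s n : ℝ) / n)) - 1) atTop (𝓝 0) := by
    have h1 := ((Real.continuous_exp.tendsto _).comp
      (hsn.tendsto_div_nhds_zero.const_mul 3)).sub_const 1
    simpa using h1
  refine aas_of_real_compl_le hlim ?_
  filter_upwards [hG, hp, hsn.bound one_pos, eventually_gt_atTop 0] with n hGn hpn hsn hn
  have hsn' : s n ≤ n := by
    simp only [Real.norm_natCast, one_mul] at hsn
    exact_mod_cast hsn
  have hn0 : (0 : ℝ) < n := by exact_mod_cast hn
  have hs0 : (0 : ℝ) < s n := by exact_mod_cast hs n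
  have hL : 0 ≤ Real.log ((n : ℝ) / s n) :=
    Real.log_nonneg ((one_le_div hs0).2 (by exact_mod_cast hsn'))
  have hks' : 17 * k n ≤ s n := by
    have := hks n
    rw [le_div_iff₀ (by norm_num)] at this
    rw [mul_comm]
    exact_mod_cast this
  have h := binomialRandom_real_not_isVertexConnected_le (G n) (hk n) hks'
    (by rwa [Fintype.card_fin]) (card_filter_adj_ge_of_le_minDeg (G n) hGn.ge) (p n) (by
      rw [Fintype.card_fin]
      rw [div_le_iff₀ (by positivity)] at hpn
      exact (mul_le_mul_of_nonneg_right hc (by positivity)).trans hpn)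
  rw [Fintype.card_fin] at h
  refine le_of_eq_of_le ?_ h
  congr 1
  ext R
  exact not_congr (le_vertexConnectivity_iff _ (hk n))

/-! ### Disjoint cliques -/

/-- The disjoint union of `q` cliques of almost equal sizes: the residue classes modulo `q`. -/
def residueCliques (n q : ℕ) : SimpleGraph (Fin n) where
  Adj i j := i ≠ j ∧ (i : ℕ) % q = j % q
  symm := ⟨fun _ _ h => ⟨h.1.symm, h.2.symm⟩⟩
  loopless := ⟨fun _ h => h.1 rfl⟩

/-- The vertices of `Fin n` that are congruent to `r` modulo `q`. It is empty for `r ≥ q > 0`. -/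
def residueClass (n q r : ℕ) : Finset (Fin n) :=
  Finset.univ.filter fun i => (i : ℕ) % q = r

theorem mem_residueClass {n q r : ℕ} {i : Fin n} : i ∈ residueClass n q r ↔ (i : ℕ) % q = r := by
  simp [residueClass]

theorem card_residueClass {n q r : ℕ} (hr : r < q) :
    n / q ≤ (residueClass n q r).card ∧ (residueClass n q r).card ≤ n / q + 1 := by
  have h : (residueClass n q r).card = n.count (· ≡ r [MOD q]) := by
    rw [Nat.count_eq_card_filter_range, residueClass, Finset.card_filter, Finset.card_filter,
      ← Fin.sum_univ_eq_sum_range (fun i => if i ≡ r [MOD q] then 1 else 0)]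
    refine Finset.sum_congr rfl fun i _ => ?_
    simp only [Nat.ModEq, Nat.mod_eq_of_lt hr]
  rw [h, Nat.count_modEq_card n (by omega)]
  split_ifs <;> omega

theorem disjoint_residueClass {n q r r' : ℕ} (h : r ≠ r') :
    Disjoint (residueClass n q r) (residueClass n q r') := by
  rw [Finset.disjoint_left]
  intro i hi hi'
  exact h ((mem_residueClass.1 hi).symm.trans (mem_residueClass.1 hi'))

theorem le_minDeg_residueCliques {n q s : ℕ} (hn : 0 < n) (hq : 0 < q) (hs : s + 1 ≤ n / q) :
    s ≤ minDeg (residueCliques n q) := by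
  have : Nonempty (Fin n) := ⟨⟨0, hn⟩⟩
  let _ : DecidableRel (residueCliques n q).Adj := Classical.decRel _
  change s ≤ (residueCliques n q).minDegree
  refine SimpleGraph.le_minDegree_of_forall_le_degree _ _ fun v => ?_
  have h := (card_residueClass (n := n) (Nat.mod_lt v hq)).1
  have hsub : (residueClass n q (v % q)).erase v ⊆ (residueCliques n q).neighborFinset v := by
    intro w hw
    rw [Finset.mem_erase, mem_residueClass] at hw
    rw [SimpleGraph.mem_neighborFinset]
    exact ⟨hw.1.symm, hw.2.symm⟩
  have h1 := Finset.card_le_card hsub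
  rw [Finset.card_erase_of_mem (mem_residueClass.2 rfl),
    SimpleGraph.card_neighborFinset_eq_degree] at h1
  omega

/-- Deleting the ends of the edges of `H` that leave a clique separates the rest of this clique. -/
theorem isSeparation_residueClass {n q r : ℕ} {H : SimpleGraph (Fin n)} {X : Finset (Fin n)}
    (hX : ∀ u ∈ residueClass n q r, ∀ w ∉ residueClass n q r, H.Adj u w → u ∈ X)
    (hXC : X ⊆ residueClass n q r) (hcard : X.card < (residueClass n q r).card)
    (hne : (residueClass n q r)ᶜ.Nonempty) :
    IsSeparation (residueCliques n q ⊔ H) X (residueClass n q r \ X) (residueClass n q r)ᶜ where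
  left_nonempty := by
    obtain ⟨v, hv, hvX⟩ := Finset.exists_mem_notMem_of_card_lt_card hcard
    exact ⟨v, Finset.mem_sdiff.2 ⟨hv, hvX⟩⟩
  right_nonempty := hne
  disjoint := (disjoint_compl_right).mono_left Finset.sdiff_subset
  disjoint_left := Finset.sdiff_disjoint
  disjoint_right := (disjoint_compl_left).mono_right hXC
  cover v := by
    simp only [Finset.mem_sdiff, Finset.mem_compl]
    tauto
  not_adj a ha b hb hab := by
    rw [Finset.mem_sdiff] at ha
    rw [Finset.mem_compl] at hb
    rcases hab with hab | hab
    · exact hb (mem_residueClass.2 (hab.2.symm.trans (mem_residueClass.1 ha.1)))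
    · exact ha.2 (hX a ha.1 b hb hab)

theorem compl_residueClass_nonempty {n q r : ℕ} (hq : 2 ≤ q) (hqn : q ≤ n) :
    (residueClass n q r)ᶜ.Nonempty := by
  by_cases hr : r = 0
  · refine ⟨⟨1, by omega⟩, ?_⟩
    rw [Finset.mem_compl, mem_residueClass, Nat.mod_eq_of_lt hq]
    simp [hr]
  · refine ⟨⟨0, by omega⟩, ?_⟩
    rw [Finset.mem_compl, mem_residueClass, Nat.zero_mod]
    exact fun h => hr h.symm

theorem card_innerDarts_univ {V : Type*} [Fintype V] (H : SimpleGraph V)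
    [DecidableRel H.Adj] : (innerDarts H Finset.univ).card ≤ 2 * H.edgeSet.ncard := by
  classical
  have h : innerDarts H Finset.univ ⊆
      (Finset.univ : Finset H.Dart).image SimpleGraph.Dart.toProd := by
    intro e he
    exact Finset.mem_image.2 ⟨⟨e, (Finset.mem_filter.1 he).2⟩, Finset.mem_univ _, rfl⟩
  refine ((Finset.card_le_card h).trans Finset.card_image_le).trans ?_
  rw [Finset.card_univ, SimpleGraph.dart_card_eq_twice_card_edges, Set.ncard_eq_toFinset_card']
  exact le_of_eq (congrArg (2 * ·) (congrArg Finset.card (by ext; simp)))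

/-- Some clique is left by at most the average number of edges. -/
theorem vertexConnectivity_residueCliques_sup_lt {n q k : ℕ} (hk : 0 < k) (hq : 2 ≤ q)
    (hqn : q ≤ n) (hkn : k ≤ n / q) {H : SimpleGraph (Fin n)}
    (hH : 2 * H.edgeSet.ncard < k * q) : vertexConnectivity (residueCliques n q ⊔ H) < k := by
  classical
  let L : ℕ → Finset (Fin n × Fin n) := fun r => (innerDarts H Finset.univ).filter fun e =>
    e.1 ∈ residueClass n q r ∧ e.2 ∉ residueClass n q r
  obtain ⟨r, hr, hLr⟩ : ∃ r ∈ Finset.range q, (L r).card < k := by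
    by_contra hcon
    push Not at hcon
    have h1 := Finset.card_nsmul_le_sum _ _ _ hcon
    rw [← Finset.card_biUnion, Finset.card_range, smul_eq_mul, mul_comm] at h1
    · have h2 : ((Finset.range q).biUnion L).card ≤ (innerDarts H Finset.univ).card :=
        Finset.card_le_card (Finset.biUnion_subset.2 fun r _ => Finset.filter_subset _ _)
      have h3 := card_innerDarts_univ H
      omega
    · intro r _ r' _ hrr'
      rw [Function.onFun, Finset.disjoint_left]
      intro e he he'
      exact Finset.disjoint_left.1 (disjoint_residueClass hrr') (Finset.mem_filter.1 he).2.1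
        (Finset.mem_filter.1 he').2.1
  have hXk : ((L r).image Prod.fst).card < k := Finset.card_image_le.trans_lt hLr
  have hC := (card_residueClass (n := n) (Finset.mem_range.1 hr)).1
  have hsep : IsSeparation (residueCliques n q ⊔ H) ((L r).image Prod.fst) _ _ :=
    isSeparation_residueClass (q := q) (r := r)
      (fun u hu w hw huw => Finset.mem_image.2 ⟨(u, w), by simp [L, innerDarts, hu, hw, huw], rfl⟩)
      (fun u hu => by
        obtain ⟨e, he, rfl⟩ := Finset.mem_image.1 hu
        exact (Finset.mem_filter.1 he).2.1)
      (by omega) (compl_residueClass_nonempty hq hqn)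
  rw [← not_le, le_vertexConnectivity_iff _ hk]
  exact hsep.not_isVertexConnected hXk

/-! ### Isolated cliques -/

/-- The second moment method for events whose pairwise correlations are at most `1 + θ`. -/
theorem measureReal_forall_notMem_le {Ω ι : Type*} [MeasurableSpace Ω] (μ : Measure Ω)
    [IsProbabilityMeasure μ] (S : Finset ι) {E : ι → Set Ω} (hE : ∀ i, MeasurableSet (E i))
    {θ : ℝ} (hθ : 0 ≤ θ) (hcorr : ∀ i ∈ S, ∀ j ∈ S, i ≠ j →
      μ.real (E i ∩ E j) ≤ (1 + θ) * (μ.real (E i) * μ.real (E j)))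
    (hm : 0 < ∑ i ∈ S, μ.real (E i)) :
    μ.real {ω | ∀ i ∈ S, ω ∉ E i} ≤ 1 / (∑ i ∈ S, μ.real (E i)) + θ := by
  classical
  set m := ∑ i ∈ S, μ.real (E i) with hmdef
  let X : Ω → ℝ := fun ω => ∑ i ∈ S, (E i).indicator 1 ω
  have hint : ∀ A : Set Ω, MeasurableSet A → Integrable (A.indicator (1 : Ω → ℝ)) μ := fun A hA =>
    (integrable_const (1 : ℝ)).indicator hA
  have hX : Integrable X μ := integrable_finsetSum _ fun i _ => hint _ (hE i)
  have hXint : ∫ ω, X ω ∂μ = m := by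
    rw [integral_finsetSum _ fun i _ => hint _ (hE i)]
    exact Finset.sum_congr rfl fun i _ => integral_indicator_one (hE i)
  have hXX : (fun ω => X ω ^ 2) =
      fun ω => ∑ i ∈ S, ∑ j ∈ S, (E i ∩ E j).indicator (1 : Ω → ℝ) ω := by
    funext ω
    simp only [X, sq, Finset.sum_mul_sum, Set.inter_indicator_one, Pi.mul_apply]
  have hXX_int : Integrable (fun ω => X ω ^ 2) μ := by
    rw [hXX]
    exact integrable_finsetSum _ fun i _ => integrable_finsetSum _ fun j _ =>
      hint _ ((hE i).inter (hE j))
  have hXX_le : ∫ ω, X ω ^ 2 ∂μ ≤ m + (1 + θ) * m ^ 2 := by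
    rw [hXX, integral_finsetSum _ fun i _ => integrable_finsetSum _ fun j _ =>
      hint _ ((hE i).inter (hE j))]
    calc ∑ i ∈ S, ∫ ω, ∑ j ∈ S, (E i ∩ E j).indicator (1 : Ω → ℝ) ω ∂μ
        = ∑ i ∈ S, ∑ j ∈ S, μ.real (E i ∩ E j) := by
          refine Finset.sum_congr rfl fun i _ => ?_
          rw [integral_finsetSum _ fun j _ => hint _ ((hE i).inter (hE j))]
          exact Finset.sum_congr rfl fun j _ => integral_indicator_one ((hE i).inter (hE j))
      _ ≤ ∑ i ∈ S, ∑ j ∈ S, ((if i = j then μ.real (E i) else 0) +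
            (1 + θ) * (μ.real (E i) * μ.real (E j))) := by
          refine Finset.sum_le_sum fun i hi => Finset.sum_le_sum fun j hj => ?_
          by_cases hij : i = j
          · subst hij
            have : 0 ≤ (1 + θ) * (μ.real (E i) * μ.real (E i)) := by positivity
            simpa using this
          · simpa [hij] using hcorr i hi j hj hij
      _ = m + (1 + θ) * m ^ 2 := by
          simp only [Finset.sum_add_distrib, Finset.sum_ite_eq, ← Finset.mul_sum,
            ← Finset.sum_mul, hmdef, sq]
          congr 1
          exact Finset.sum_congr rfl fun i hi => by simp [hi]
  have hsq : (fun ω => (X ω - m) ^ 2) = fun ω => X ω ^ 2 - 2 * m * X ω + m ^ 2 := by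
    funext ω
    ring
  have hlin_int : Integrable (fun ω => X ω ^ 2 - 2 * m * X ω) μ := hXX_int.sub (hX.const_mul _)
  have hdev_int : Integrable (fun ω => (X ω - m) ^ 2) μ := by
    rw [hsq]
    exact hlin_int.add (integrable_const _)
  have hdev : ∫ ω, (X ω - m) ^ 2 ∂μ ≤ m + θ * m ^ 2 := by
    rw [hsq, integral_add hlin_int (integrable_const _),
      integral_sub hXX_int (hX.const_mul _), integral_const_mul, hXint]
    simp only [integral_const, probReal_univ, one_smul]
    linarith
  have hmarkov := mul_meas_ge_le_integral_of_nonneg (μ := μ)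
    (f := fun ω => (X ω - m) ^ 2) (.of_forall fun ω => sq_nonneg _) hdev_int (m ^ 2)
  have hsub : μ.real {ω | ∀ i ∈ S, ω ∉ E i} ≤ μ.real {ω | m ^ 2 ≤ (X ω - m) ^ 2} := by
    refine measureReal_mono (fun ω hω => ?_) (measure_ne_top _ _)
    have : X ω = 0 := Finset.sum_eq_zero fun i hi => Set.indicator_of_notMem (hω i hi) _
    simp [this]
  have h2 : m ^ 2 * μ.real {ω | ∀ i ∈ S, ω ∉ E i} ≤ m + θ * m ^ 2 :=
    ((mul_le_mul_of_nonneg_left hsub (sq_nonneg m)).trans hmarkov).trans hdev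
  have h3 : m + θ * m ^ 2 = m ^ 2 * (1 / m + θ) := by
    field_simp
  rw [h3] at h2
  exact le_of_mul_le_mul_left h2 (by positivity)

/-- The potential edges that leave the residue class `r`. -/
def leavingPairs (n q r : ℕ) : Finset (Sym2 (Fin n)) :=
  (residueClass n q r ×ˢ (residueClass n q r)ᶜ).image fun e => s(e.1, e.2)

theorem not_isDiag_of_mem_leavingPairs {n q r : ℕ} {e : Sym2 (Fin n)}
    (he : e ∈ leavingPairs n q r) : ¬ e.IsDiag := by
  obtain ⟨a, ha, rfl⟩ := Finset.mem_image.1 he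
  rw [Finset.mem_product] at ha
  intro h
  exact Finset.mem_compl.1 ha.2 (Sym2.mk_isDiag_iff.1 h ▸ ha.1)

theorem card_leavingPairs_le (n q r : ℕ) :
    (leavingPairs n q r).card ≤ (residueClass n q r).card * n := by
  refine Finset.card_image_le.trans ?_
  rw [Finset.card_product]
  refine Nat.mul_le_mul_left _ ((Finset.card_le_univ _).trans ?_)
  rw [Fintype.card_fin]

theorem card_leavingPairs_inter_le {n q r r' : ℕ} (h : r ≠ r') :
    (leavingPairs n q r ∩ leavingPairs n q r').card ≤
      (residueClass n q r).card * (residueClass n q r').card := by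
  rw [← Finset.card_product]
  refine (Finset.card_le_card fun e he => ?_).trans
    (Finset.card_image_le (f := fun e : Fin n × Fin n => s(e.1, e.2)))
  rw [Finset.mem_inter] at he
  obtain ⟨⟨a, b⟩, hab, rfl⟩ := Finset.mem_image.1 he.1
  obtain ⟨⟨c, d⟩, hcd, hs⟩ := Finset.mem_image.1 he.2
  simp only [Finset.mem_product, Finset.mem_compl] at hab hcd
  rcases Sym2.eq_iff.1 hs with ⟨rfl, rfl⟩ | ⟨rfl, rfl⟩
  · exact absurd hcd.1 (Finset.disjoint_left.1 (disjoint_residueClass h) hab.1)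
  · exact Finset.mem_image_of_mem _ (Finset.mk_mem_product hab.1 hcd.1)

theorem binomialRandom_real_notMem {V : Type*} [Finite V] (p : I) {F : Finset (Sym2 V)}
    (hF : ∀ e ∈ F, ¬ e.IsDiag) :
    (SimpleGraph.binomialRandom V p).real {R | ∀ e ∈ F, e ∉ R.edgeSet} =
      (1 - (p : ℝ)) ^ F.card := by
  classical
  simpa using binomialRandom_real_subset_disjoint p (M := ∅) (by simp) hF (by simp)

/-- The second moment method, applied to the number of cliques that no random edge leaves. Here `c`
bounds the clique sizes; two cliques have at most `c ^ 2` potential edges in common, which bounds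
the correlation. -/
theorem binomialRandom_real_vertexConnectivity_ne_zero_le {n q c : ℕ} (hq : 2 ≤ q) (hqn : q ≤ n)
    (hc : ∀ r < q, (residueClass n q r).card ≤ c) {p : I} (hp : (p : ℝ) < 1)
    (hcp : (c : ℝ) ^ 2 * p ≤ 1 / 2) :
    (SimpleGraph.binomialRandom (Fin n) p).real
        {R | ¬ vertexConnectivity (residueCliques n q ⊔ R) = 0} ≤
      1 / (q * Real.exp (-(p * (c * n) / (1 - p)))) + 2 * ((c : ℝ) ^ 2 * p) := by
  set μ := SimpleGraph.binomialRandom (Fin n) p with hμ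
  let E : ℕ → Set (SimpleGraph (Fin n)) := fun r => {R | ∀ e ∈ leavingPairs n q r, e ∉ R.edgeSet}
  have hp0 : (0 : ℝ) ≤ p := p.2.1
  have h1p : (0 : ℝ) < 1 - p := sub_pos.2 hp
  have hE : ∀ r, μ.real (E r) = (1 - (p : ℝ)) ^ (leavingPairs n q r).card := fun r =>
    binomialRandom_real_notMem p fun e he => not_isDiag_of_mem_leavingPairs he
  have hfirst : ∀ r ∈ Finset.range q,
      Real.exp (-(p * (c * n) / (1 - p))) ≤ μ.real (E r) := by
    intro r hr
    have hcard : (leavingPairs n q r).card ≤ c * n :=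
      (card_leavingPairs_le n q r).trans (Nat.mul_le_mul_right n (hc r (Finset.mem_range.1 hr)))
    have hbase : Real.exp (-(p / (1 - p))) ≤ 1 - (p : ℝ) := by
      have h := Real.add_one_le_exp ((p : ℝ) / (1 - p))
      rw [Real.exp_neg]
      refine inv_le_of_inv_le₀ h1p (le_of_eq_of_le ?_ h)
      field_simp
      ring
    rw [hE]
    calc Real.exp (-(p * (c * n) / (1 - p))) = Real.exp (-(p / (1 - p))) ^ (c * n) := by
          rw [← Real.exp_nat_mul]
          push_cast
          congr 1
          ring
      _ ≤ (1 - (p : ℝ)) ^ (c * n) := pow_le_pow_left₀ (Real.exp_nonneg _) hbase _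
      _ ≤ (1 - (p : ℝ)) ^ (leavingPairs n q r).card :=
          pow_le_pow_of_le_one h1p.le (by linarith) hcard
  have hcorr : ∀ r ∈ Finset.range q, ∀ r' ∈ Finset.range q, r ≠ r' →
      μ.real (E r ∩ E r') ≤ (1 + 2 * ((c : ℝ) ^ 2 * p)) * (μ.real (E r) * μ.real (E r')) := by
    intro r hr r' hr' hrr'
    have hinter : E r ∩ E r' =
        {R | ∀ e ∈ leavingPairs n q r ∪ leavingPairs n q r', e ∉ R.edgeSet} := by
      ext R
      simp only [E, Set.mem_inter_iff, Set.mem_ofPred_eq, Finset.mem_union, or_imp, forall_and]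
    have hcard : (leavingPairs n q r).card + (leavingPairs n q r').card ≤
        (leavingPairs n q r ∪ leavingPairs n q r').card + c ^ 2 := by
      rw [← Finset.card_union_add_card_inter]
      refine Nat.add_le_add_left ((card_leavingPairs_inter_le hrr').trans ?_) _
      rw [sq]
      exact Nat.mul_le_mul (hc r (Finset.mem_range.1 hr)) (hc r' (Finset.mem_range.1 hr'))
    have hbern : 1 - (c : ℝ) ^ 2 * p ≤ (1 - (p : ℝ)) ^ (c ^ 2) := by
      have h := one_add_mul_le_pow (a := -(p : ℝ)) (by linarith [p.2.2]) (c ^ 2)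
      push_cast at h
      rw [← sub_eq_add_neg] at h
      linarith
    rw [hinter, hμ, binomialRandom_real_notMem p fun e he => (Finset.mem_union.1 he).elim
      not_isDiag_of_mem_leavingPairs not_isDiag_of_mem_leavingPairs, ← hμ, hE, hE]
    have hpow : (1 - (p : ℝ)) ^ (leavingPairs n q r ∪ leavingPairs n q r').card *
        (1 - (c : ℝ) ^ 2 * p) ≤
        (1 - (p : ℝ)) ^ (leavingPairs n q r).card * (1 - (p : ℝ)) ^ (leavingPairs n q r').card := by
      calc _ ≤ (1 - (p : ℝ)) ^ (leavingPairs n q r ∪ leavingPairs n q r').card *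
            (1 - (p : ℝ)) ^ (c ^ 2) := mul_le_mul_of_nonneg_left hbern (by positivity)
        _ ≤ _ := by
            rw [← pow_add, ← pow_add]
            exact pow_le_pow_of_le_one h1p.le (by linarith) hcard
    set t : ℝ := (c : ℝ) ^ 2 * p
    set u : ℝ := (1 - (p : ℝ)) ^ (leavingPairs n q r ∪ leavingPairs n q r').card
    have ht : 0 ≤ t := by positivity
    have hu : 0 ≤ u := by positivity
    -- `(1 + 2 * t) * (1 - t) ≥ 1` for `0 ≤ t ≤ 1 / 2`
    have h1 : 1 ≤ (1 + 2 * t) * (1 - t) := by nlinarith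
    calc u = u * 1 := (mul_one u).symm
      _ ≤ u * ((1 + 2 * t) * (1 - t)) := mul_le_mul_of_nonneg_left h1 hu
      _ = (1 + 2 * t) * (u * (1 - t)) := by ring
      _ ≤ _ := mul_le_mul_of_nonneg_left hpow (by positivity)
  have hsum : q * Real.exp (-(p * (c * n) / (1 - p))) ≤ ∑ r ∈ Finset.range q, μ.real (E r) := by
    have h := Finset.card_nsmul_le_sum _ _ _ hfirst
    rwa [Finset.card_range, nsmul_eq_mul] at h
  have hq0 : (0 : ℝ) < q := by exact_mod_cast (by omega : 0 < q)
  have hpos : 0 < q * Real.exp (-(p * (c * n) / (1 - p))) := by positivity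
  have hsub : {R | ¬ vertexConnectivity (residueCliques n q ⊔ R) = 0} ⊆
      {R | ∀ r ∈ Finset.range q, R ∉ E r} := by
    intro R hR r hr hRE
    have hC := (card_residueClass (n := n) (Finset.mem_range.1 hr)).1
    have hnq : 0 < n / q := Nat.div_pos hqn (by omega)
    have hsep := isSeparation_residueClass (q := q) (r := r) (H := R) (X := ∅)
      (fun u hu w hw huw => absurd huw (hRE s(u, w) (Finset.mem_image.2
        ⟨(u, w), Finset.mk_mem_product hu (Finset.mem_compl.2 hw), rfl⟩)))
      (Finset.empty_subset _) (by rw [Finset.card_empty]; omega)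
      (compl_residueClass_nonempty hq hqn)
    exact hsep.not_isVertexConnected (k := 1) (by simp)
      ((le_vertexConnectivity_iff _ one_pos).1 (Nat.one_le_iff_ne_zero.2 hR))
  refine (measureReal_mono hsub (measure_ne_top _ _)).trans ?_
  refine (measureReal_forall_notMem_le μ (Finset.range q) (fun r => measurableSet_simpleGraph _)
    (by positivity) hcorr (hpos.trans_le hsum)).trans ?_
  gcongr

/-- Below the threshold some clique is isolated. With `x = n / s`, `L = log x`, `q = n / (s + 1)`
cliques of sizes at most `s * C`, where `C → 1`, and `P = L / (n * s)`, the choice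
`1 - ε = (1 - 1 / √L) * (1 - P) / C` bounds the number of vertex pairs to avoid so that a clique is
isolated with probability at least `exp (√L - L) = exp (√L) / x`. Since `q ≥ x / 4`, the expected
number of isolated cliques tends to infinity. -/
theorem exists_aas_vertexConnectivity_eq_zero {s : ℕ → ℕ} (hs : ∀ n, 0 < s n)
    (hs_top : Tendsto s atTop atTop)
    (hsn : (fun n => (s n : ℝ)) =o[atTop] (fun n : ℕ => (n : ℝ))) :
    ∃ ε : ℕ → ℝ, Tendsto ε atTop (𝓝 0) ∧ ∀ p : ℕ → I,
      (∀ᶠ n : ℕ in atTop, (p n : ℝ) ≤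
        (1 - ε n) * Real.log ((n : ℝ) / (s n : ℝ)) / ((n : ℝ) * (s n : ℝ))) →
      AAS p (fun n R => vertexConnectivity (residueCliques n (n / (s n + 1)) ⊔ R) = 0) := by
  let x : ℕ → ℝ := fun n => (n : ℝ) / s n
  let L : ℕ → ℝ := fun n => Real.log (x n)
  let P : ℕ → ℝ := fun n => L n / (n * s n)
  let q : ℕ → ℕ := fun n => n / (s n + 1)
  let C : ℕ → ℝ := fun n => (1 + 1 / (q n : ℝ)) * (1 + 1 / (s n : ℝ)) + 1 / (s n : ℝ)
  have hs0 : ∀ n, (0 : ℝ) < s n := fun n => by exact_mod_cast hs n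
  have hs1 : ∀ n, (1 : ℝ) ≤ s n := fun n => by exact_mod_cast hs n
  have hx : Tendsto x atTop atTop := by
    have h1 : Tendsto (fun n : ℕ => (s n : ℝ) / n) atTop (𝓝[>] 0) := by
      refine tendsto_nhdsWithin_iff.2 ⟨hsn.tendsto_div_nhds_zero, ?_⟩
      filter_upwards [eventually_gt_atTop 0] with n hn
      have : (0 : ℝ) < n := by exact_mod_cast hn
      exact div_pos (hs0 n) this
    refine h1.inv_tendsto_nhdsGT_zero.congr fun n => ?_
    simp [x]
  have hL : Tendsto L atTop atTop := Real.tendsto_log_atTop.comp hx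
  have hsqrt : Tendsto (fun n => √(L n)) atTop atTop := Real.tendsto_sqrt_atTop.comp hL
  have hLx : Tendsto (fun n => L n / x n) atTop (𝓝 0) :=
    Real.isLittleO_log_id_atTop.tendsto_div_nhds_zero.comp hx
  have hP0 : ∀ᶠ n in atTop, 0 ≤ P n := by
    filter_upwards [hL.eventually_ge_atTop 0] with n hn
    exact div_nonneg hn (by have := hs0 n; positivity)
  have hP : Tendsto P atTop (𝓝 0) := by
    refine squeeze_zero' hP0 ?_ hLx
    filter_upwards [hL.eventually_ge_atTop 0, eventually_gt_atTop 0] with n hn hn0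
    have hn0' : (0 : ℝ) < n := by exact_mod_cast hn0
    have hs' := hs0 n
    refine div_le_div_of_nonneg_left hn (by positivity) ?_
    calc (n : ℝ) / s n ≤ n := div_le_self hn0'.le (hs1 n)
      _ ≤ n * s n := le_mul_of_one_le_right hn0'.le (hs1 n)
  have hdiv : ∀ n : ℕ, (n : ℝ) < (q n + 1) * (s n + 1) := fun n => by
    exact_mod_cast (Nat.div_lt_iff_lt_mul (Nat.succ_pos (s n))).1 (Nat.lt_succ_self (q n))
  have hqx : ∀ n, x n / 2 - 1 ≤ q n := by
    intro n
    have h2 : (n : ℝ) ≤ (q n + 1) * (2 * s n) :=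
      (hdiv n).le.trans (mul_le_mul_of_nonneg_left (by linarith [hs1 n]) (by positivity))
    have h3 : x n ≤ (q n + 1) * 2 := by
      rw [div_le_iff₀ (hs0 n)]
      linarith
    linarith
  have hq : Tendsto (fun n => (q n : ℝ)) atTop atTop := by
    refine tendsto_atTop_mono hqx ?_
    exact tendsto_atTop_add_const_right _ _ (hx.atTop_div_const two_pos)
  have hsr : Tendsto (fun n => (s n : ℝ)) atTop atTop := tendsto_natCast_atTop_atTop.comp hs_top
  have hC : Tendsto C atTop (𝓝 1) := by
    have h1 : Tendsto (fun n => 1 / (q n : ℝ)) atTop (𝓝 0) := hq.const_div_atTop 1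
    have h2 : Tendsto (fun n => 1 / (s n : ℝ)) atTop (𝓝 0) := hsr.const_div_atTop 1
    have h3 : Tendsto C atTop (𝓝 ((1 + 0) * (1 + 0) + 0)) :=
      ((h1.const_add 1).mul (h2.const_add 1)).add h2
    rwa [add_zero, add_zero, mul_one] at h3
  have hC1 : ∀ n, 1 ≤ C n := by
    intro n
    have h1 : 0 ≤ 1 / (q n : ℝ) := by positivity
    have h2 : 0 ≤ 1 / (s n : ℝ) := by positivity
    have h3 := mul_nonneg h1 h2
    have h4 : C n = 1 + 1 / (q n : ℝ) + 2 * (1 / (s n : ℝ)) + 1 / (q n : ℝ) * (1 / (s n : ℝ)) := by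
      simp only [C]
      ring
    rw [h4]
    linarith
  refine ⟨fun n => 1 - (1 - 1 / √(L n)) * (1 - P n) / C n, ?_, fun p hp => ?_⟩
  · have h1 : Tendsto (fun n => 1 / √(L n)) atTop (𝓝 0) := hsqrt.const_div_atTop 1
    have h2 := (((h1.const_sub 1).mul (hP.const_sub 1)).div hC one_ne_zero).const_sub 1
    simpa using h2
  · have hlim : Tendsto (fun n => 4 / Real.exp (√(L n)) + 8 * (L n / x n)) atTop (𝓝 0) := by
      have h1 := (Real.tendsto_exp_atTop.comp hsqrt).const_div_atTop 4
      simpa using h1.add (hLx.const_mul 8)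
    refine aas_of_real_compl_le hlim ?_
    filter_upwards [hp, hP0, hP.eventually_le_const one_half_pos, hC.eventually_le_const one_lt_two,
      hx.eventually_ge_atTop 6, hL.eventually_ge_atTop 1,
      hLx.eventually_le_const (by norm_num : (0 : ℝ) < 1 / 8), eventually_gt_atTop 0]
      with n hpn hP0 hP2 hC2 hx6 hL1 hLx8 hn
    have hn0 : (0 : ℝ) < n := by exact_mod_cast hn
    have hs' := hs0 n
    have hx0 : 0 < x n := by linarith
    have hL0 : 0 < L n := by linarith
    have hC0 : 0 < C n := by linarith [hC1 n]
    have hp0 : (0 : ℝ) ≤ p n := (p n).2.1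
    have hq2 : 2 ≤ q n := by
      have : (2 : ℝ) ≤ q n := by linarith [hqx n]
      exact_mod_cast this
    have hq0 : (0 : ℝ) < q n := by exact_mod_cast (by omega : 0 < q n)
    have hqn : q n ≤ n := Nat.div_le_self _ _
    have hsqrt1 : 1 ≤ √(L n) := Real.one_le_sqrt.2 hL1
    have hinv : 1 / √(L n) ≤ 1 := (div_le_one (by linarith)).2 hsqrt1
    have hinv0 : 0 ≤ 1 / √(L n) := by positivity
    -- the sizes of the cliques
    have hc : ((n / q n + 1 : ℕ) : ℝ) ≤ s n * C n := by
      have h1 := hdiv n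
      have h2 : ((n / q n : ℕ) : ℝ) ≤ (n : ℝ) / q n := Nat.cast_div_le
      have h3 : (n : ℝ) / q n ≤ (q n + 1) * (s n + 1) / q n := by gcongr
      have h4 : s n * C n = (q n + 1) * (s n + 1) / q n + 1 := by
        simp only [C]
        field_simp
      rw [h4]
      push_cast
      linarith
    have hpn' : (p n : ℝ) ≤ (1 - 1 / √(L n)) * (1 - P n) / C n * P n := by
      refine hpn.trans (le_of_eq ?_)
      rw [sub_sub_cancel, mul_div_assoc]
    have hb0 := hp0.trans hpn'
    have hpP : (p n : ℝ) ≤ P n := by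
      refine hpn'.trans (mul_le_of_le_one_left hP0 ?_)
      rw [div_le_one hC0]
      exact (mul_le_one₀ (by linarith) (by linarith) (by linarith)).trans (hC1 n)
    have hPns : P n * (n * s n) = L n := by
      simp only [P]
      field_simp
    have hPss : P n * (s n) ^ 2 = L n / x n := by
      simp only [P, x]
      field_simp
    have hexp : (p n : ℝ) * (((n / q n + 1 : ℕ) : ℝ) * n) / (1 - p n) ≤ L n - √(L n) := by
      calc (p n : ℝ) * (((n / q n + 1 : ℕ) : ℝ) * n) / (1 - p n)
          ≤ (1 - 1 / √(L n)) * (1 - P n) / C n * P n * (s n * C n * n) / (1 - P n) := by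
            refine div_le_div₀ (mul_nonneg hb0 (by positivity)) ?_ (by linarith) (by linarith)
            exact mul_le_mul hpn' (mul_le_mul_of_nonneg_right hc hn0.le) (by positivity) hb0
        _ = (1 - 1 / √(L n)) * (P n * (n * s n)) := by
            have : 1 - P n ≠ 0 := by linarith
            field_simp
        _ = L n - L n / √(L n) := by rw [hPns]; ring
        _ = L n - √(L n) := by rw [Real.div_sqrt]
    have hcp : ((n / q n + 1 : ℕ) : ℝ) ^ 2 * p n ≤ 4 * (L n / x n) := by
      calc ((n / q n + 1 : ℕ) : ℝ) ^ 2 * p n ≤ (s n * 2) ^ 2 * P n := by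
            gcongr
            exact hc.trans (by gcongr)
        _ = 4 * (L n / x n) := by rw [← hPss]; ring
    refine (binomialRandom_real_vertexConnectivity_ne_zero_le hq2 hqn
      (fun r hr => (card_residueClass hr).2) (by linarith) (by linarith)).trans ?_
    refine add_le_add ?_ (by linarith)
    have hmean : Real.exp (√(L n)) / 4 ≤
        q n * Real.exp (-((p n : ℝ) * (((n / q n + 1 : ℕ) : ℝ) * n) / (1 - p n))) := by
      calc Real.exp (√(L n)) / 4 = x n / 4 * Real.exp (-(L n - √(L n))) := by
            rw [neg_sub, Real.exp_sub, Real.exp_log hx0]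
            field_simp
        _ ≤ _ := mul_le_mul (by linarith [hqx n]) (Real.exp_le_exp.2 (neg_le_neg hexp))
            (Real.exp_nonneg _) hq0.le
    calc 1 / (q n * Real.exp (-((p n : ℝ) * (((n / q n + 1 : ℕ) : ℝ) * n) / (1 - p n))))
        ≤ 1 / (Real.exp (√(L n)) / 4) := one_div_le_one_div_of_le (by positivity) hmean
      _ = 4 / Real.exp (√(L n)) := by rw [one_div_div]

theorem theorem1p5 :
    -- Part (a); the constant is absolute.
    (∃ c₀ : ℝ, 0 < c₀ ∧ ∀ c : ℝ, c₀ ≤ c →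
      ∀ (k s : ℕ → ℕ), (∀ n, 0 < k n) → (∀ n, 0 < s n) →
      (∀ n, (k n : ℝ) ≤ (s n : ℝ) / 17) →
      (fun n => (s n : ℝ)) =o[atTop] (fun n : ℕ => (n : ℝ)) →
      ∀ (G : ∀ n : ℕ, SimpleGraph (Fin n)), (∀ᶠ n in atTop, minDeg (G n) = s n) →
      ∀ (p : ℕ → I),
      (∀ᶠ n : ℕ in atTop,
        c * ((k n : ℝ) + Real.log ((n : ℝ) / (s n : ℝ))) / ((n : ℝ) * (s n : ℝ)) ≤ (p n : ℝ)) →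
      AAS p (fun n R => k n ≤ vertexConnectivity (G n ⊔ R))) ∧
    -- Part (b); the same graphs `G₀ n` serve both assertions.
    (∀ (k s : ℕ → ℕ), (∀ n, 0 < k n) → (∀ n, 0 < s n) →
      (∀ n, (k n : ℝ) ≤ (s n : ℝ) / 17) →
      ∃ G₀ : ∀ n : ℕ, SimpleGraph (Fin n),
        (∀ n : ℕ, 2 * (s n + 1) ≤ n →
          s n ≤ minDeg (G₀ n) ∧
          ∀ H : SimpleGraph (Fin n),
            (H.edgeSet.ncard : ℝ) < (k n : ℝ) * ((n / (s n + 1) : ℕ) : ℝ) / 2 →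
            vertexConnectivity (G₀ n ⊔ H) < k n) ∧
        (Tendsto s atTop atTop →
          (fun n => (s n : ℝ)) =o[atTop] (fun n : ℕ => (n : ℝ)) →
          ∃ ε : ℕ → ℝ, Tendsto ε atTop (𝓝 0) ∧
            ∀ (p : ℕ → I),
            (∀ᶠ n : ℕ in atTop,
              (p n : ℝ) ≤
                (1 - ε n) * Real.log ((n : ℝ) / (s n : ℝ)) / ((n : ℝ) * (s n : ℝ))) →
            AAS p (fun n R => vertexConnectivity (G₀ n ⊔ R) = 0))) := by
  refine ⟨⟨1088, by norm_num, fun c hc k s hk hs hks hsn G hG p hp =>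
    aas_le_vertexConnectivity hc hk hs hks hsn hG hp⟩, fun k s hk hs hks =>
    ⟨fun n => residueCliques n (n / (s n + 1)), fun n hn => ?_,
      fun hs_top hsn => exists_aas_vertexConnectivity_eq_zero hs hs_top hsn⟩⟩
  have hq : 2 ≤ n / (s n + 1) := (Nat.le_div_iff_mul_le (Nat.succ_pos _)).2 hn
  have hsize : s n + 1 ≤ n / (n / (s n + 1)) :=
    (Nat.le_div_iff_mul_le (by omega)).2 (Nat.mul_div_le n (s n + 1))
  have hkn : k n ≤ s n := by
    have h := hks n
    rw [le_div_iff₀ (by norm_num)] at h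
    have : k n * 17 ≤ s n := by exact_mod_cast h
    omega
  refine ⟨le_minDeg_residueCliques (by omega) (by omega) hsize, fun H hH =>
    vertexConnectivity_residueCliques_sup_lt (hk n) hq (Nat.div_le_self _ _) (by omega) ?_⟩
  rw [lt_div_iff₀ two_pos, mul_comm] at hH
  exact_mod_cast hH
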